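/- Let $a,b,c$ be nonnegative integers and let $r,s,t$ be integers with $0\le r\le a+2$, $0\le s\le b+2$, $0\le t\le c+2$. In the triangular lattice with unit side length (placed so that one of the three lattice directions is vertical), consider the hexagon with all angles equal to $120^\circ$ and with sides of lengths $a+2,c+2,b+2,a+2,c+2,b+2$ in counterclockwise order, beginning with the upper left side. A rhombus is the union of two unit lattice triangles with a common side, and a rhombus tiling of the hexagon is a set of rhombi contained in the hexagon such that each unit lattice triangle in the hexagon lies in exactly one of them. Fix three rhombi, each of which has an acute corner on a side of the hexagon and its long diagonal perpendicular to that side: * one with its acute corner on the lower right side (of length $a+2$), at distance $r$ from the lower end of that side; * one with its acute corner on the upper right side (of length $b+2$), at distance $s$ from the lower (right) end of that side; * one with its acute corner on the left side (of length $c+2$), at distance $t$ from the upper end of that side. Then the number of rhombus tilings of the hexagon that contain these three rhombi equals $$(r+1)_b\,(s+1)_c\,(t+1)_a\,(c+3-t)_b\,(a+3-r)_c\,(b+3-s)_a\;\frac{\prod_{k=0}^{a}k!\,\prod_{k=0}^{b}k!\,\prod_{k=0}^{c}k!\,\prod_{k=0}^{a+b+c+2}k!}{\prod_{k=0}^{b+c+2}k!\,\prod_{k=0}^{a+c+2}k!\,\prod_{k=0}^{a+b+2}k!}$$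 $$\times\Big((a+1)(b+1)(c+1)(a+2-r)(b+2-s)(c+2-t)+(a+1)(b+1)(c+1)\,rst-(a+2-r)(b+2-s)(c+2-t)\,rst$$ $$+(a+1)(c+1)(b+2-s)(c+2-t)\,rs+(b+1)(a+1)(c+2-t)(a+2-r)\,st+(c+1)(b+1)(a+2-r)(b+2-s)\,tr\Big),$$ where $(x)_n=x(x+1)\cdots(x+n-1)$. -/

import Mathlib

/-!
The triangular lattice. The pair `(x, y) : ℤ × ℤ` stands for the point
`x • (√3/2, 1/2) + y • (0, 1)` of the plane, so that the six unit vectors of the lattice are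
`±(1, 0)` (at angle 30°), `±(0, 1)` (at angle 90°) and `±(1, -1)` (at angle -30°).
-/

namespace RhombusTiling

/-- The unit triangles of the triangular lattice. Each has one vertical side:
`right x y` points to the right and `left x y` points to the left. -/
inductive UnitTriangle where
  | right (x y : ℤ)
  | left (x y : ℤ)

/-- The three corners of a unit triangle. -/
def UnitTriangle.vertices : UnitTriangle → Set (ℤ × ℤ)
  | .right x y => {(x, y), (x, y + 1), (x + 1, y)}
  | .left x y => {(x + 1, y + 1), (x + 1, y), (x, y + 1)}

/-- The unit rhombi that consist of two unit triangles of the lattice with a common side.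
The three constructors are the three possible orientations:
* `A x y` has the sides `(1, 0)` and `(1, -1)`, and `(x, y)` is its leftmost corner;
* `B x y` has the sides `(1, 0)` and `(0, 1)`, and `(x, y)` is its lowest corner;
* `C x y` has the sides `(1, -1)` and `(0, 1)`, and `(x, y)` is its lower left corner. -/
inductive Rhombus where
  | A (x y : ℤ)
  | B (x y : ℤ)
  | C (x y : ℤ)

/-- The four corners of a rhombus. -/
def Rhombus.vertices : Rhombus → Set (ℤ × ℤ)
  | .A x y => {(x, y), (x + 1, y), (x + 1, y - 1), (x + 2, y - 1)}
  | .B x y => {(x, y), (x + 1, y), (x, y + 1), (x + 1, y + 1)}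
  | .C x y => {(x, y), (x + 1, y - 1), (x, y + 1), (x + 1, y)}

/-- The lattice points of the (closed) hexagon with all angles equal to 120° and with side lengths
`α, γ, β, α, γ, β` in counterclockwise order, beginning with the upper left side. Its corners are,
in counterclockwise order from the top,
`(α, γ), (0, γ), (0, 0), (β, -β), (α + β, -β), (α + β, γ - β)`. -/
def hexagon (α β γ : ℕ) : Set (ℤ × ℤ) :=
  {p | 0 ≤ p.1 ∧ p.1 ≤ α + β ∧ -(β : ℤ) ≤ p.2 ∧ p.2 ≤ γ ∧ 0 ≤ p.1 + p.2 ∧ p.1 + p.2 ≤ α + γ}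

/-- A set `T` of rhombi is a tiling of the convex region with lattice points `H` if all its members
lie in the region and each unit triangle in the region lies in exactly one member of `T`.
(A unit triangle lies in a rhombus or in a convex lattice region iff its corners do.) -/
def IsTiling (H : Set (ℤ × ℤ)) (T : Set Rhombus) : Prop :=
  (∀ R ∈ T, R.vertices ⊆ H) ∧
    ∀ Δ : UnitTriangle, Δ.vertices ⊆ H → ∃! R : Rhombus, R ∈ T ∧ Δ.vertices ⊆ R.vertices

/-- The fixed tile at the lower right side (of length `α`): its long diagonal is perpendicular to
that side, and it has an acute corner on that side, namely `(β + r, -β)`, at distance `r` from the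
lowest corner `(β, -β)` of the hexagon. -/
def tileLowerRight (β r : ℕ) : Rhombus :=
  .C (β + r - 1) (-β + 1)

/-- The fixed tile at the upper right side (of length `β`): its long diagonal is perpendicular to
that side, and it has an acute corner on that side, namely `(α + β - s, γ - β + s)`, at distance `s`
from the upper end `(α + β, γ - β)` of the right side of the hexagon. -/
def tileUpperRight (α β γ s : ℕ) : Rhombus :=
  .B (α + β - s - 1) (γ - β + s - 1)

/-- The fixed tile at the left side (of length `γ`): its long diagonal is perpendicular to
that side, and it has an acute corner on that side, namely `(0, γ - t)`, at distance `t` from the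
upper end `(0, γ)` of that side. -/
def tileLeft (γ t : ℕ) : Rhombus :=
  .A 0 (γ - t)

/-- The tilings of the hexagon with sides `a + 2, c + 2, b + 2, a + 2, c + 2, b + 2` that contain
the three fixed tiles in positions `r, s, t` at the sides of length `a + 2, b + 2, c + 2`. -/
def tilings (a b c r s t : ℕ) : Set (Set Rhombus) :=
  {T | IsTiling (hexagon (a + 2) (b + 2) (c + 2)) T ∧
    tileLowerRight (b + 2) r ∈ T ∧
    tileUpperRight (a + 2) (b + 2) (c + 2) s ∈ T ∧
    tileLeft (c + 2) t ∈ T}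

/-- The rising factorial `(x)_n = x (x + 1) ⋯ (x + n - 1)`. -/
def rising (x : ℚ) (n : ℕ) : ℚ :=
  ∏ i ∈ Finset.range n, (x + i)

/-- The product `∏_{k=0}^{n} k!`. -/
def prodFactorial (n : ℕ) : ℚ :=
  ∏ k ∈ Finset.range (n + 1), (k.factorial : ℚ)

end RhombusTiling

/-! Following the rhombi with vertical sides (types `B` and `C`) from left to right turns a tiling
into c+2 non-intersecting paths from the left side to the right side: a `B` keeps the height, a `C`
lowers it by one, and the `A` rhombi fill what the paths leave free. The tile on the left side says
that the paths starting at height at least c+2-t begin with `B` and the others with `C`, so after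
one step the occupied heights are -1, ..., c+1 without c+1-t. A path that enters the lowest row
(along the lower right side) or the highest row (along the upper right side) never leaves it, so the
other two tiles prescribe where these rows are entered.

The paths are counted by a Lindström–Gessel–Viennot determinant, proved column by column in
`ncard_completions_eq_det`. That argument only needs weights that obey the one-step recursion,
vanish outside the hexagon and have determinant 1 on the right side. This freedom is used to move
the middle endpoints horizontally: with k = height + 1, the middle entries on the line x = 1 become
constants times C(k+b, e) / ((k+b)! (a+c+2-k)!) for 0 ≤ e < c.

To evaluate the determinant, the missing height is restored and marked by a bordering unit row
(`borderedMatrix`), and the result is multiplied by `weightMatrix`, with entries (-1)^k C(c+2, k)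
(k+b)! (a+c+2-k)! times the falling factorial of k of length j. In the path rows, entries of the
product are then finite differences of order c+2, so a middle row, of degree e, vanishes in column j
when e+j < c+2. The product is block triangular: a triangular c × c block, and a 3 × 3 block from
the unit row, the lowest and the highest endpoint against j = 0, 1, 2. The latter produces the last
factor of the formula (`det_three_eq`). Signs are only tracked up to a sign independent of r, s, t,
which positivity at r = s = t = 0 settles. -/

namespace RhombusTiling

/-! ### Local geometry: triangles and rhombi in terms of vertical edges -/

/-- The vertical unit edge from `(x, y)` to `(x, y + 1)` lies in the hexagon. -/
def Edge (α β γ : ℕ) (x y : ℤ) : Prop :=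
  0 ≤ x ∧ x ≤ α + β ∧ -(β : ℤ) ≤ y ∧ y + 1 ≤ γ ∧ 0 ≤ x + y ∧ x + y + 1 ≤ α + γ

/-- Exactly one of three propositions holds. -/
def ExactlyOne (p q r : Prop) : Prop := (p ∨ q ∨ r) ∧ ¬(p ∧ q) ∧ ¬(p ∧ r) ∧ ¬(q ∧ r)

/-- The index of the leftmost column of unit triangles that a rhombus meets. -/
def Rhombus.column : Rhombus → ℤ
  | .A x _ => x
  | .B x _ => x
  | .C x _ => x

section Geometry

variable {α β γ : ℕ} {x y : ℤ}

theorem right_subset_hexagon :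
    (UnitTriangle.right x y).vertices ⊆ hexagon α β γ ↔ Edge α β γ x y ∧ x < α + β := by
  simp only [UnitTriangle.vertices, hexagon, Edge, Set.insert_subset_iff,
    Set.singleton_subset_iff, Set.mem_ofPred_eq]
  omega

theorem left_subset_hexagon :
    (UnitTriangle.left x y).vertices ⊆ hexagon α β γ ↔ 0 ≤ x ∧ Edge α β γ (x + 1) y := by
  simp only [UnitTriangle.vertices, hexagon, Edge, Set.insert_subset_iff,
    Set.singleton_subset_iff, Set.mem_ofPred_eq]
  omega

theorem A_subset_hexagon : (Rhombus.A x y).vertices ⊆ hexagon α β γ ↔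
    0 ≤ x ∧ x + 2 ≤ α + β ∧ Edge α β γ (x + 1) (y - 1) := by
  simp only [Rhombus.vertices, hexagon, Edge, Set.insert_subset_iff,
    Set.singleton_subset_iff, Set.mem_ofPred_eq]
  omega

theorem B_subset_hexagon : (Rhombus.B x y).vertices ⊆ hexagon α β γ ↔
    Edge α β γ x y ∧ Edge α β γ (x + 1) y := by
  simp only [Rhombus.vertices, hexagon, Edge, Set.insert_subset_iff,
    Set.singleton_subset_iff, Set.mem_ofPred_eq]
  omega

theorem C_subset_hexagon : (Rhombus.C x y).vertices ⊆ hexagon α β γ ↔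
    Edge α β γ x y ∧ Edge α β γ (x + 1) (y - 1) := by
  simp only [Rhombus.vertices, hexagon, Edge, Set.insert_subset_iff,
    Set.singleton_subset_iff, Set.mem_ofPred_eq]
  omega

/-- A unit triangle has three sides, and gluing its neighbour across each of them gives one rhombus
of each orientation. -/
theorem right_subset_rhombus {R : Rhombus} : (UnitTriangle.right x y).vertices ⊆ R.vertices ↔
    R = .B x y ∨ R = .C x y ∨ R = .A (x - 1) (y + 1) := by
  cases R <;>
  · simp only [UnitTriangle.vertices, Rhombus.vertices, Set.insert_subset_iff,
      Set.singleton_subset_iff, Set.mem_insert_iff, Set.mem_singleton_iff, Prod.mk.injEq,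
      Rhombus.A.injEq, Rhombus.B.injEq, Rhombus.C.injEq, reduceCtorEq, false_or, or_false]
    omega

theorem left_subset_rhombus {R : Rhombus} : (UnitTriangle.left x y).vertices ⊆ R.vertices ↔
    R = .B x y ∨ R = .C x (y + 1) ∨ R = .A x (y + 1) := by
  cases R <;>
  · simp only [UnitTriangle.vertices, Rhombus.vertices, Set.insert_subset_iff,
      Set.singleton_subset_iff, Set.mem_insert_iff, Set.mem_singleton_iff, Prod.mk.injEq,
      Rhombus.A.injEq, Rhombus.B.injEq, Rhombus.C.injEq, reduceCtorEq, false_or, or_false]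
    omega

theorem existsUnique_mem_iff_exactlyOne {ι : Type*} {T : Set ι} {a b c : ι}
    (hab : a ≠ b) (hac : a ≠ c) (hbc : b ≠ c) :
    (∃! R, R ∈ T ∧ (R = a ∨ R = b ∨ R = c)) ↔ ExactlyOne (a ∈ T) (b ∈ T) (c ∈ T) := by
  constructor
  · rintro ⟨R, ⟨hR, h⟩, hu⟩
    have ha : a ∈ T → a = R := fun h => hu a ⟨h, by simp⟩
    have hb : b ∈ T → b = R := fun h => hu b ⟨h, by simp⟩
    have hc : c ∈ T → c = R := fun h => hu c ⟨h, by simp⟩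
    refine ⟨?_, ?_, ?_, ?_⟩
    · rcases h with rfl | rfl | rfl <;> tauto
    · exact fun h => hab ((ha h.1).trans (hb h.2).symm)
    · exact fun h => hac ((ha h.1).trans (hc h.2).symm)
    · exact fun h => hbc ((hb h.1).trans (hc h.2).symm)
  · rintro ⟨h | h | h, h1, h2, h3⟩
    · refine ⟨a, ⟨h, by simp⟩, ?_⟩
      rintro R ⟨hR, rfl | rfl | rfl⟩ <;> tauto
    · refine ⟨b, ⟨h, by simp⟩, ?_⟩
      rintro R ⟨hR, rfl | rfl | rfl⟩ <;> tauto
    · refine ⟨c, ⟨h, by simp⟩, ?_⟩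
      rintro R ⟨hR, rfl | rfl | rfl⟩ <;> tauto

/-- Being a tiling of the hexagon, in terms of the vertical edges. -/
structure IsHexagonTiling (α β γ : ℕ) (T : Set Rhombus) : Prop where
  A_mem : ∀ {x y}, Rhombus.A x y ∈ T → 0 ≤ x ∧ x + 2 ≤ α + β ∧ Edge α β γ (x + 1) (y - 1)
  B_mem : ∀ {x y}, Rhombus.B x y ∈ T → Edge α β γ x y ∧ Edge α β γ (x + 1) y
  C_mem : ∀ {x y}, Rhombus.C x y ∈ T → Edge α β γ x y ∧ Edge α β γ (x + 1) (y - 1)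
  right : ∀ {x y}, Edge α β γ x y → x < α + β →
    ExactlyOne (.B x y ∈ T) (.C x y ∈ T) (.A (x - 1) (y + 1) ∈ T)
  left : ∀ {x y}, 0 ≤ x → Edge α β γ (x + 1) y →
    ExactlyOne (.B x y ∈ T) (.C x (y + 1) ∈ T) (.A x (y + 1) ∈ T)

theorem isTiling_hexagon_iff {T : Set Rhombus} :
    IsTiling (hexagon α β γ) T ↔ IsHexagonTiling α β γ T := by
  have hr : ∀ x y, (∃! R : Rhombus, R ∈ T ∧ (UnitTriangle.right x y).vertices ⊆ R.vertices) ↔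
      ExactlyOne (.B x y ∈ T) (.C x y ∈ T) (.A (x - 1) (y + 1) ∈ T) := fun x y => by
    simp only [right_subset_rhombus]
    exact existsUnique_mem_iff_exactlyOne (by simp) (by simp) (by simp)
  have hl : ∀ x y, (∃! R : Rhombus, R ∈ T ∧ (UnitTriangle.left x y).vertices ⊆ R.vertices) ↔
      ExactlyOne (.B x y ∈ T) (.C x (y + 1) ∈ T) (.A x (y + 1) ∈ T) := fun x y => by
    simp only [left_subset_rhombus]
    exact existsUnique_mem_iff_exactlyOne (by simp) (by simp) (by simp)
  constructor
  · rintro ⟨h1, h2⟩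
    exact ⟨fun h => A_subset_hexagon.1 (h1 _ h), fun h => B_subset_hexagon.1 (h1 _ h),
      fun h => C_subset_hexagon.1 (h1 _ h),
      fun h h' => (hr _ _).1 (h2 _ (right_subset_hexagon.2 ⟨h, h'⟩)),
      fun h h' => (hl _ _).1 (h2 _ (left_subset_hexagon.2 ⟨h, h'⟩))⟩
  · intro h
    refine ⟨?_, ?_⟩
    · rintro (⟨x, y⟩ | ⟨x, y⟩ | ⟨x, y⟩) hR
      · exact A_subset_hexagon.2 (h.A_mem hR)
      · exact B_subset_hexagon.2 (h.B_mem hR)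
      · exact C_subset_hexagon.2 (h.C_mem hR)
    · rintro (⟨x, y⟩ | ⟨x, y⟩) hΔ
      · obtain ⟨h1, h2⟩ := right_subset_hexagon.1 hΔ
        exact (hr x y).2 (h.right h1 h2)
      · obtain ⟨h1, h2⟩ := left_subset_hexagon.1 hΔ
        exact (hl x y).2 (h.left h1 h2)

end Geometry


/-! ### Partial tilings and removal of their first column -/

/-- `T` tiles the part of the hexagon to the right of the vertical line with abscissa `x₀`, apart
from the triangles touching that line at an edge outside `Y`; all tiles satisfy `P`. -/
structure IsCompletion (α β γ : ℕ) (P : Rhombus → Prop) (x₀ : ℤ) (Y : Set ℤ)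
    (T : Set Rhombus) : Prop where
  A_mem : ∀ {x y}, Rhombus.A x y ∈ T → x₀ ≤ x ∧ x + 2 ≤ α + β ∧ Edge α β γ (x + 1) (y - 1)
  B_mem : ∀ {x y}, Rhombus.B x y ∈ T → x₀ ≤ x ∧ Edge α β γ x y ∧ Edge α β γ (x + 1) y
  C_mem : ∀ {x y}, Rhombus.C x y ∈ T → x₀ ≤ x ∧ Edge α β γ x y ∧ Edge α β γ (x + 1) (y - 1)
  allowed : ∀ R ∈ T, P R
  sub : ∀ y ∈ Y, Edge α β γ x₀ y
  last : x₀ = α + β → ∀ y, Edge α β γ x₀ y → y ∈ Y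
  start : ∀ y ∈ Y, x₀ < α + β → (.B x₀ y ∈ T ∨ .C x₀ y ∈ T) ∧ ¬(.B x₀ y ∈ T ∧ .C x₀ y ∈ T)
  start_not : ∀ y ∉ Y, .B x₀ y ∉ T ∧ .C x₀ y ∉ T
  right : ∀ {x y}, x₀ < x → Edge α β γ x y → x < α + β →
    ExactlyOne (.B x y ∈ T) (.C x y ∈ T) (.A (x - 1) (y + 1) ∈ T)
  left : ∀ {x y}, x₀ ≤ x → Edge α β γ (x + 1) y →
    ExactlyOne (.B x y ∈ T) (.C x (y + 1) ∈ T) (.A x (y + 1) ∈ T)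

/-- The heights after one step, where exactly the paths in `s` stay at the same height. -/
def stepHeights {n : ℕ} (y : Fin n → ℤ) (s : Finset (Fin n)) (i : Fin n) : ℤ :=
  if i ∈ s then y i else y i - 1

/-- The tiles in the column right of the line `x₀` that realize a step. -/
def columnTiles (α β γ : ℕ) {n : ℕ} (x₀ : ℤ) (y : Fin n → ℤ) (s : Finset (Fin n)) :
    Set Rhombus :=
  {R | (∃ i ∈ s, R = .B x₀ (y i)) ∨ (∃ i ∉ s, R = .C x₀ (y i)) ∨
    ∃ v, Edge α β γ (x₀ + 1) v ∧ v ∉ Set.range (stepHeights y s) ∧ R = .A x₀ (v + 1)}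

section Decomposition

variable {α β γ n : ℕ} {P : Rhombus → Prop} {x₀ : ℤ} {y : Fin n → ℤ} {s : Finset (Fin n)}

theorem B_mem_columnTiles {x v : ℤ} :
    Rhombus.B x v ∈ columnTiles α β γ x₀ y s ↔ x = x₀ ∧ ∃ i ∈ s, y i = v := by
  simp only [columnTiles, Set.mem_ofPred_eq, Rhombus.B.injEq, reduceCtorEq, and_false,
    exists_false, or_false]
  constructor
  · rintro ⟨i, hi, rfl, rfl⟩; exact ⟨rfl, i, hi, rfl⟩
  · rintro ⟨rfl, i, hi, rfl⟩; exact ⟨i, hi, rfl, rfl⟩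

theorem C_mem_columnTiles {x v : ℤ} :
    Rhombus.C x v ∈ columnTiles α β γ x₀ y s ↔ x = x₀ ∧ ∃ i ∉ s, y i = v := by
  simp only [columnTiles, Set.mem_ofPred_eq, Rhombus.C.injEq, reduceCtorEq, and_false,
    exists_false, or_false, false_or]
  constructor
  · rintro ⟨i, hi, rfl, rfl⟩; exact ⟨rfl, i, hi, rfl⟩
  · rintro ⟨rfl, i, hi, rfl⟩; exact ⟨i, hi, rfl, rfl⟩

theorem A_mem_columnTiles {x v : ℤ} :
    Rhombus.A x v ∈ columnTiles α β γ x₀ y s ↔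
      x = x₀ ∧ Edge α β γ (x₀ + 1) (v - 1) ∧ v - 1 ∉ Set.range (stepHeights y s) := by
  simp only [columnTiles, Set.mem_ofPred_eq, Rhombus.A.injEq, reduceCtorEq, and_false,
    exists_false, false_or]
  constructor
  · rintro ⟨w, h1, h2, rfl, rfl⟩; rw [add_sub_cancel_right]; exact ⟨rfl, h1, h2⟩
  · rintro ⟨rfl, h1, h2⟩; exact ⟨v - 1, h1, h2, rfl, by ring⟩

theorem mem_range_stepHeights {v : ℤ} : v ∈ Set.range (stepHeights y s) ↔
    (∃ i ∈ s, y i = v) ∨ ∃ i ∉ s, y i = v + 1 := by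
  constructor
  · rintro ⟨i, rfl⟩
    by_cases hi : i ∈ s
    · exact .inl ⟨i, hi, by simp [stepHeights, hi]⟩
    · exact .inr ⟨i, hi, by simp [stepHeights, hi]⟩
  · rintro (⟨i, hi, rfl⟩ | ⟨i, hi, h⟩)
    · exact ⟨i, by simp [stepHeights, hi]⟩
    · exact ⟨i, by simp [stepHeights, hi, h]⟩

/-- Two paths arriving at the same edge would cover the left triangle there twice; injectivity of
the new heights excludes this. -/
theorem not_exists_stepHeights (hz : Function.Injective (stepHeights y s)) {v : ℤ} :
    ¬((∃ i ∈ s, y i = v) ∧ ∃ i ∉ s, y i = v + 1) := by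
  rintro ⟨⟨i, hi, rfl⟩, j, hj, h⟩
  have : i = j := hz (by simp [stepHeights, hi, hj, h])
  exact hj (this ▸ hi)

/-- The new column is tiled correctly because each left triangle in it is reached by exactly one
path or by none, and in the latter case an `A` tile takes it together with the right triangle in the
next column. -/
theorem IsCompletion.extend (hx : x₀ < α + β) (hy : Function.Injective y)
    (hE : ∀ i, Edge α β γ x₀ (y i)) (hz : Function.Injective (stepHeights y s))
    (hP : ∀ R ∈ columnTiles α β γ x₀ y s, P R) {T : Set Rhombus}
    (h : IsCompletion α β γ P (x₀ + 1) (Set.range (stepHeights y s)) T) :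
    IsCompletion α β γ P x₀ (Set.range y) (T ∪ columnTiles α β γ x₀ y s) := by
  have hA0 : ∀ {v}, Rhombus.A x₀ v ∉ T := fun hv => by have := (h.A_mem hv).1; omega
  have hB0 : ∀ {v}, Rhombus.B x₀ v ∉ T := fun hv => by have := (h.B_mem hv).1; omega
  have hC0 : ∀ {v}, Rhombus.C x₀ v ∉ T := fun hv => by have := (h.C_mem hv).1; omega
  constructor
  case A_mem =>
    rintro x v (hv | hv)
    · obtain ⟨h1, h2⟩ := h.A_mem hv
      exact ⟨by omega, h2⟩
    · obtain ⟨rfl, h1, h2⟩ := A_mem_columnTiles.1 hv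
      refine ⟨le_rfl, ?_, h1⟩
      -- An `A` tile also occupies the next column, so none may be placed next to the right side;
      -- there `last` says that every edge is reached by a path.
      by_contra hc
      exact h2 (h.last (by omega) _ h1)
  case B_mem =>
    rintro x v (hv | hv)
    · obtain ⟨h1, h2⟩ := h.B_mem hv
      exact ⟨by omega, h2⟩
    · obtain ⟨rfl, i, hi, rfl⟩ := B_mem_columnTiles.1 hv
      exact ⟨le_rfl, hE i, h.sub _ ⟨i, by simp [stepHeights, hi]⟩⟩
  case C_mem =>
    rintro x v (hv | hv)
    · obtain ⟨h1, h2⟩ := h.C_mem hv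
      exact ⟨by omega, h2⟩
    · obtain ⟨rfl, i, hi, rfl⟩ := C_mem_columnTiles.1 hv
      exact ⟨le_rfl, hE i, h.sub _ ⟨i, by simp [stepHeights, hi]⟩⟩
  case allowed =>
    rintro R (hR | hR)
    exacts [h.allowed R hR, hP R hR]
  case sub => rintro _ ⟨i, rfl⟩; exact hE i
  case last => exact fun hc => absurd hc hx.ne
  case start =>
    rintro _ ⟨i, rfl⟩ -
    simp only [Set.mem_union, hB0, hC0, false_or, B_mem_columnTiles, C_mem_columnTiles, true_and,
      hy.eq_iff, exists_eq_right]
    tauto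
  case start_not =>
    intro v hv
    simp only [Set.mem_union, hB0, hC0, false_or, B_mem_columnTiles, C_mem_columnTiles, true_and]
    constructor
    · rintro ⟨i, -, rfl⟩; exact hv ⟨i, rfl⟩
    · rintro ⟨i, -, rfl⟩; exact hv ⟨i, rfl⟩
  case right =>
    intro x v hx1 hv hx2
    simp only [Set.mem_union, B_mem_columnTiles, C_mem_columnTiles, hx1.ne', false_and, or_false,
      A_mem_columnTiles, add_sub_cancel_right]
    obtain rfl | hx3 := eq_or_ne x (x₀ + 1)
    · simp only [add_sub_cancel_right, hA0, false_or, true_and, hv, ExactlyOne]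
      by_cases hr : v ∈ Set.range (stepHeights y s)
      · have := h.start v hr hx2
        tauto
      · have := h.start_not v hr
        tauto
    · have h3 : x - 1 ≠ x₀ := by omega
      simp only [h3, false_and, or_false]
      exact h.right (by omega) hv hx2
  case left =>
    intro x v hx1 hv
    simp only [Set.mem_union, B_mem_columnTiles, C_mem_columnTiles, A_mem_columnTiles,
      add_sub_cancel_right]
    obtain rfl | hx3 := eq_or_ne x x₀
    · simp only [hA0, hB0, hC0, hv, false_or, true_and, mem_range_stepHeights]
      have := not_exists_stepHeights hz (v := v)
      unfold ExactlyOne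
      generalize (∃ i ∈ s, y i = v) = p at this ⊢
      generalize (∃ i ∉ s, y i = v + 1) = q at this ⊢
      tauto
    · simp only [hx3, false_and, or_false]
      exact h.left (by omega) hv

theorem column_of_mem_columnTiles {R : Rhombus} (h : R ∈ columnTiles α β γ x₀ y s) :
    R.column = x₀ := by
  rcases h with ⟨i, -, rfl⟩ | ⟨i, -, rfl⟩ | ⟨v, -, -, rfl⟩ <;> rfl

theorem IsCompletion.le_column {Y : Set ℤ} {T : Set Rhombus} (h : IsCompletion α β γ P x₀ Y T)
    {R : Rhombus} (hR : R ∈ T) : x₀ ≤ R.column := by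
  cases R with
  | A x v => exact (h.A_mem hR).1
  | B x v => exact (h.B_mem hR).1
  | C x v => exact (h.C_mem hR).1

-- The `B` tiles of the first column determine `s`: `start` forces a `C` on every other path, and
-- the left triangles not reached force the `A` tiles. Everything in later columns is the smaller
-- completion.
open Classical in
theorem IsCompletion.exists_extend (hx : x₀ < α + β) (hx0 : 0 ≤ x₀) (hy : Function.Injective y)
    {T : Set Rhombus} (h : IsCompletion α β γ P x₀ (Set.range y) T) :
    ∃ s T', Function.Injective (stepHeights y s) ∧ (∀ R ∈ columnTiles α β γ x₀ y s, P R) ∧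
      IsCompletion α β γ P (x₀ + 1) (Set.range (stepHeights y s)) T' ∧
      T = T' ∪ columnTiles α β γ x₀ y s := by
  set s : Finset (Fin n) := Finset.univ.filter fun i => Rhombus.B x₀ (y i) ∈ T with hs
  have hsB : ∀ i, i ∈ s ↔ Rhombus.B x₀ (y i) ∈ T := by simp [hs]
  have hsC : ∀ i, i ∉ s ↔ Rhombus.C x₀ (y i) ∈ T := fun i => by
    have := h.start (y i) ⟨i, rfl⟩ hx
    rw [hsB]; tauto
  have hB : ∀ v, Rhombus.B x₀ v ∈ T ↔ ∃ i ∈ s, y i = v := fun v => by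
    constructor
    · intro hv
      have : v ∈ Set.range y := by
        by_contra hc
        exact (h.start_not v hc).1 hv
      obtain ⟨i, rfl⟩ := this
      exact ⟨i, (hsB i).2 hv, rfl⟩
    · rintro ⟨i, hi, rfl⟩; exact (hsB i).1 hi
  have hC : ∀ v, Rhombus.C x₀ v ∈ T ↔ ∃ i ∉ s, y i = v := fun v => by
    constructor
    · intro hv
      have : v ∈ Set.range y := by
        by_contra hc
        exact (h.start_not v hc).2 hv
      obtain ⟨i, rfl⟩ := this
      exact ⟨i, (hsC i).2 hv, rfl⟩
    · rintro ⟨i, hi, rfl⟩; exact (hsC i).1 hi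
  have hr : ∀ v, v ∈ Set.range (stepHeights y s) ↔
      Rhombus.B x₀ v ∈ T ∨ Rhombus.C x₀ (v + 1) ∈ T := fun v => by
    rw [mem_range_stepHeights, hB, hC]
  have hrE : ∀ v ∈ Set.range (stepHeights y s), Edge α β γ (x₀ + 1) v := fun v hv => by
    rcases (hr v).1 hv with h1 | h1
    · exact (h.B_mem h1).2.2
    · simpa using (h.C_mem h1).2.2
  have hA : ∀ v, Rhombus.A x₀ v ∈ T ↔
      Edge α β γ (x₀ + 1) (v - 1) ∧ v - 1 ∉ Set.range (stepHeights y s) := fun v => by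
    rw [hr]
    constructor
    · intro hv
      have h1 := (h.A_mem hv).2.2
      have := h.left le_rfl h1
      simp only [sub_add_cancel, ExactlyOne] at this ⊢
      tauto
    · rintro ⟨h1, h2⟩
      have := h.left le_rfl h1
      simp only [sub_add_cancel, ExactlyOne] at this h2 ⊢
      tauto
  have hT : T = {R ∈ T | x₀ + 1 ≤ R.column} ∪ columnTiles α β γ x₀ y s := by
    ext R
    have key : R.column = x₀ → (R ∈ T ↔ R ∈ columnTiles α β γ x₀ y s) := by
      rintro rfl
      cases R with
      | A x v => rw [A_mem_columnTiles]; simpa [Rhombus.column] using hA v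
      | B x v => rw [B_mem_columnTiles]; simpa [Rhombus.column] using hB v
      | C x v => rw [C_mem_columnTiles]; simpa [Rhombus.column] using hC v
    constructor
    · intro hR
      have := h.le_column hR
      obtain h1 | h1 := this.eq_or_lt
      · exact .inr ((key h1.symm).1 hR)
      · exact .inl ⟨hR, h1⟩
    · rintro (hR | hR)
      · exact hR.1
      · exact (key (column_of_mem_columnTiles hR)).2 hR
  refine ⟨s, {R ∈ T | x₀ + 1 ≤ R.column}, ?_, ?_, ?_, hT⟩
  · intro i j hij
    -- A `B` and a `C` ending at the same edge would share its left triangle.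
    have hne : ∀ i j, i ∈ s → j ∉ s → stepHeights y s i ≠ stepHeights y s j := by
      intro i j hi hj hij
      have h1 := (hsB i).1 hi
      have h2 := (hsC j).1 hj
      simp only [stepHeights, hi, hj, if_true, if_false] at hij
      have h3 := h.left le_rfl (h.B_mem h1).2.2
      rw [show y i + 1 = y j by omega] at h3
      exact h3.2.1 ⟨h1, h2⟩
    by_cases hi : i ∈ s <;> by_cases hj : j ∈ s
    · exact hy (by simpa [stepHeights, hi, hj] using hij)
    · exact absurd hij (hne i j hi hj)
    · exact absurd hij.symm (hne j i hj hi)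
    · exact hy (by simpa [stepHeights, hi, hj] using hij)
  · intro R hR
    exact h.allowed R (hT ▸ .inr hR)
  · constructor
    case A_mem => exact fun ⟨h1, h2⟩ => ⟨h2, (h.A_mem h1).2⟩
    case B_mem => exact fun ⟨h1, h2⟩ => ⟨h2, (h.B_mem h1).2⟩
    case C_mem => exact fun ⟨h1, h2⟩ => ⟨h2, (h.C_mem h1).2⟩
    case allowed => exact fun R hR => h.allowed R hR.1
    case sub => exact hrE
    case last =>
      intro hl v hv
      by_contra hc
      have := (hA (v + 1)).2 (by rw [add_sub_cancel_right]; exact ⟨hv, hc⟩)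
      have := (h.A_mem this).2.1
      omega
    case start =>
      intro v hv hx1
      have h1 := h.right (by omega) (hrE v hv) hx1
      have h2 : Rhombus.A x₀ (v + 1) ∉ T := fun hc => ((hA _).1 hc).2 (by simpa using hv)
      simp only [Set.mem_ofPred_eq, Rhombus.column, le_refl, and_true]
      simp only [add_sub_cancel_right, ExactlyOne] at h1
      tauto
    case start_not =>
      intro v hv
      simp only [Set.mem_ofPred_eq, Rhombus.column, le_refl, and_true]
      have key : Edge α β γ (x₀ + 1) v → x₀ + 1 < α + β →
          .B (x₀ + 1) v ∉ T ∧ .C (x₀ + 1) v ∉ T := fun hE hx1 => by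
        have h1 := h.right (by omega) hE hx1
        have h2 : Rhombus.A x₀ (v + 1) ∈ T := (hA _).2 (by rw [add_sub_cancel_right]; exact ⟨hE, hv⟩)
        simp only [add_sub_cancel_right, ExactlyOne] at h1
        tauto
      constructor
      · intro hc
        have h1 := (h.B_mem hc).2
        have h2 := h1.2.2.1
        exact (key h1.1 (by omega)).1 hc
      · intro hc
        have h1 := (h.C_mem hc).2
        have h2 := h1.2.2.1
        exact (key h1.1 (by omega)).2 hc
    case right =>
      intro x v h1 h2 h3
      have h4 : x₀ + 1 ≤ x := by omega
      have h5 : x₀ + 1 ≤ x - 1 := by omega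
      simpa only [Set.mem_ofPred_eq, Rhombus.column, h4, h5, and_true] using h.right (by omega) h2 h3
    case left =>
      intro x v h1 h2
      simpa only [Set.mem_ofPred_eq, Rhombus.column, h1, and_true] using h.left (by omega) h2

/-- Both `s` and `T'` can be recovered from the union. This makes the decomposition into first steps
disjoint and each of its maps injective. -/
theorem mem_iff_of_eq_union_columnTiles (hy : Function.Injective y) {T T' : Set Rhombus}
    (h : ∀ R ∈ T', x₀ + 1 ≤ R.column) (hT : T = T' ∪ columnTiles α β γ x₀ y s) :
    (∀ i, i ∈ s ↔ Rhombus.B x₀ (y i) ∈ T) ∧ T' = {R ∈ T | x₀ + 1 ≤ R.column} := by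
  subst hT
  constructor
  · intro i
    have : Rhombus.B x₀ (y i) ∉ T' := fun hc => by
      have := h _ hc
      simp [Rhombus.column] at this
    simp [this, B_mem_columnTiles, hy.eq_iff]
  · ext R
    constructor
    · exact fun hR => ⟨.inl hR, h R hR⟩
    · rintro ⟨hR | hR, h1⟩
      · exact hR
      · have := column_of_mem_columnTiles hR
        omega

end Decomposition


/-! ### Counting completions by a determinant -/

section PathCount

variable {α β γ n : ℕ} {P : Rhombus → Prop} {x₀ : ℤ}

/-- The set of completions of the tiling to the right of the line `x₀`. -/
def completions (α β γ : ℕ) (P : Rhombus → Prop) (x₀ : ℤ) {n : ℕ} (y : Fin n → ℤ) :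
    Set (Set Rhombus) :=
  {T | IsCompletion α β γ P x₀ (Set.range y) T}

open Classical in
theorem completions_eq_iUnion (hx : x₀ < α + β) (hx0 : 0 ≤ x₀) {y : Fin n → ℤ}
    (hy : Function.Injective y) (hE : ∀ i, Edge α β γ x₀ (y i)) :
    completions α β γ P x₀ y = ⋃ s : Finset (Fin n),
      if Function.Injective (stepHeights y s) ∧ ∀ R ∈ columnTiles α β γ x₀ y s, P R then
        (· ∪ columnTiles α β γ x₀ y s) '' completions α β γ P (x₀ + 1) (stepHeights y s)
      else ∅ := by
  ext T
  simp only [Set.mem_iUnion]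
  constructor
  · intro h
    obtain ⟨s, T', h1, h2, h3, h4⟩ := IsCompletion.exists_extend hx hx0 hy h
    refine ⟨s, ?_⟩
    rw [if_pos ⟨h1, h2⟩]
    exact ⟨T', h3, h4.symm⟩
  · rintro ⟨s, h⟩
    split_ifs at h with hs
    · obtain ⟨T', h3, rfl⟩ := h
      exact IsCompletion.extend hx hy hE hs.1 hs.2 h3
    · exact absurd h (Set.notMem_empty _)

open Classical in
theorem ncard_completions_succ (hx : x₀ < α + β) (hx0 : 0 ≤ x₀) {y : Fin n → ℤ}
    (hy : Function.Injective y) (hE : ∀ i, Edge α β γ x₀ (y i))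
    (hfin : ∀ s, Function.Injective (stepHeights y s) →
      (completions α β γ P (x₀ + 1) (stepHeights y s)).Finite) :
    (completions α β γ P x₀ y).Finite ∧
    (completions α β γ P x₀ y).ncard = ∑ s : Finset (Fin n),
      if Function.Injective (stepHeights y s) ∧ ∀ R ∈ columnTiles α β γ x₀ y s, P R then
        (completions α β γ P (x₀ + 1) (stepHeights y s)).ncard else 0 := by
  have hcol : ∀ s, ∀ T' ∈ completions α β γ P (x₀ + 1) (stepHeights y s), ∀ R ∈ T',
      x₀ + 1 ≤ R.column := fun s T' hT' R hR => IsCompletion.le_column hT' hR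
  have hfin' : ∀ s : Finset (Fin n), (if Function.Injective (stepHeights y s) ∧
      ∀ R ∈ columnTiles α β γ x₀ y s, P R then (· ∪ columnTiles α β γ x₀ y s) ''
        completions α β γ P (x₀ + 1) (stepHeights y s) else ∅).Finite := by
    intro s
    split_ifs with hs
    · exact (hfin s hs.1).image _
    · exact Set.finite_empty
  rw [completions_eq_iUnion hx hx0 hy hE]
  refine ⟨Set.finite_iUnion hfin', ?_⟩
  rw [Set.ncard_iUnion_of_finite hfin', finsum_eq_sum_of_fintype]
  · refine Finset.sum_congr rfl fun s _ => ?_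
    split_ifs with hs
    · refine Set.InjOn.ncard_image fun T₁ h1 T₂ h2 h12 => ?_
      rw [(mem_iff_of_eq_union_columnTiles hy (hcol s _ h1) rfl).2,
        (mem_iff_of_eq_union_columnTiles hy (hcol s _ h2) h12).2]
    · simp
  · intro s s' hne
    refine Set.disjoint_left.2 fun T h1 h2 => hne ?_
    beta_reduce at h1 h2
    split_ifs at h1 with hs
    swap; · exact absurd h1 (Set.notMem_empty _)
    split_ifs at h2 with hs'
    swap; · exact absurd h2 (Set.notMem_empty _)
    obtain ⟨T₁, h1, rfl⟩ := h1
    obtain ⟨T₂, h2, h12⟩ := h2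
    ext i
    rw [(mem_iff_of_eq_union_columnTiles hy (hcol s _ h1) rfl).1,
      (mem_iff_of_eq_union_columnTiles hy (hcol s' _ h2) h12.symm).1]

theorem forall_mem_columnTiles_iff (hPA : ∀ x v, P (.A x v)) {y : Fin n → ℤ}
    {s : Finset (Fin n)} : (∀ R ∈ columnTiles α β γ x₀ y s, P R) ↔
      (∀ i ∈ s, P (.B x₀ (y i))) ∧ ∀ i ∉ s, P (.C x₀ (y i)) := by
  constructor
  · exact fun h => ⟨fun i hi => h _ (.inl ⟨i, hi, rfl⟩), fun i hi => h _ (.inr (.inl ⟨i, hi, rfl⟩))⟩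
  · rintro ⟨h1, h2⟩ R (⟨i, hi, rfl⟩ | ⟨i, hi, rfl⟩ | ⟨v, -, -, rfl⟩)
    exacts [h1 i hi, h2 i hi, hPA _ _]

/-- Distinct heights differ by at least one and drop by at most one, so paths can meet but not jump
over each other; the sorted order survives as soon as no two heights coincide. -/
theorem monotone_stepHeights {y : Fin n → ℤ} (hy : StrictMono y) (s : Finset (Fin n)) :
    Monotone (stepHeights y s) := by
  intro i j hij
  obtain rfl | h := hij.eq_or_lt
  · exact le_rfl
  · have := hy h
    unfold stepHeights
    split_ifs <;> omega

-- Every row is a sum of a `B` part and a `C` part, so multilinearity expands the determinant over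
-- all choices `s`. A forbidden step gives a zero row and colliding paths give two equal rows, so
-- only admissible non-intersecting steps survive.
open Classical in
theorem det_step (f g : Fin n → ℤ → ℤ) (pB pC : ℤ → Prop)
    (hfg : ∀ i v, f i v = (if pB v then g i v else 0) + (if pC v then g i (v - 1) else 0))
    (y : Fin n → ℤ) :
    (Matrix.of fun j i => f i (y j)).det = ∑ s : Finset (Fin n),
      if Function.Injective (stepHeights y s) ∧ (∀ i ∈ s, pB (y i)) ∧ ∀ i ∉ s, pC (y i) then
        (Matrix.of fun j i => g i (stepHeights y s j)).det else 0 := by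
  have h1 : (Matrix.of fun j i => f i (y j)) =
      (fun j i => if pB (y j) then g i (y j) else 0) +
      (fun j i => if pC (y j) then g i (y j - 1) else 0 : Matrix (Fin n) (Fin n) ℤ) := by
    ext j i
    exact hfg i (y j)
  have h2 := Matrix.detRowAlternating.map_add_univ (R := ℤ)
    (fun j i : Fin n => if pB (y j) then g i (y j) else 0)
    (fun j i : Fin n => if pC (y j) then g i (y j - 1) else 0)
  rw [h1]
  refine h2.trans (Finset.sum_congr rfl fun s _ => ?_)
  have hrow : ∀ j, (s.piecewise (fun j i : Fin n => if pB (y j) then g i (y j) else 0)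
      (fun j i : Fin n => if pC (y j) then g i (y j - 1) else 0)) j =
      fun i => if (j ∈ s → pB (y j)) ∧ (j ∉ s → pC (y j)) then g i (stepHeights y s j)
        else 0 := by
    intro j
    by_cases hj : j ∈ s <;> simp [hj, stepHeights]
  split_ifs with hs
  · refine congrArg Matrix.det (Matrix.ext fun j i => ?_)
    refine (congrFun (hrow j) i).trans ?_
    rw [if_pos ⟨fun h => hs.2.1 j h, fun h => hs.2.2 j h⟩]
    rfl
  · by_cases hp : (∀ i ∈ s, pB (y i)) ∧ ∀ i ∉ s, pC (y i)
    · have hinj : ¬ Function.Injective (stepHeights y s) := fun h => hs ⟨h, hp⟩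
      simp only [Function.Injective, not_forall] at hinj
      obtain ⟨j, k, hjk, hne⟩ := hinj
      refine Matrix.det_zero_of_row_eq hne ?_
      refine (hrow j).trans (.trans ?_ (hrow k).symm)
      funext i
      rw [if_pos ⟨hp.1 j, hp.2 j⟩, if_pos ⟨hp.1 k, hp.2 k⟩, hjk]
    · have : ∃ j, ¬((j ∈ s → pB (y j)) ∧ (j ∉ s → pC (y j))) := by
        by_contra hc
        push Not at hc
        exact hp ⟨fun i hi => (hc i).1 hi, fun i hi => (hc i).2 hi⟩
      obtain ⟨j, hj⟩ := this
      refine Matrix.det_eq_zero_of_row_eq_zero j fun i => ?_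
      refine (congrFun (hrow j) i).trans ?_
      rw [if_neg hj]

/-- After subtracting `b`, a strictly increasing self-map of `Fin n` remains, which is the identity.
-/
theorem eq_of_strictMono_of_mem {b : ℤ} {y : Fin n → ℤ} (hy : StrictMono y)
    (h : ∀ i, b ≤ y i ∧ y i < b + n) : y = fun i : Fin n => b + (i : ℕ) := by
  let g : Fin n → Fin n := fun i => ⟨(y i - b).toNat, by have := h i; omega⟩
  have hg : StrictMono g := fun i j hij => by
    have h1 := h i
    have h2 := h j
    have h3 := hy hij
    simp only [g, Fin.mk_lt_mk]
    omega
  have hid : g = id := (hg.range_inj strictMono_id).1 (by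
    rw [(Finite.injective_iff_surjective.1 hg.injective).range_eq, Set.range_id])
  funext i
  have h1 : ((g i : Fin n) : ℕ) = i := by rw [hid]; rfl
  have h2 := h i
  simp only [g] at h1
  omega

theorem completions_last {y : Fin γ → ℤ} (hy : StrictMono y)
    (hE : ∀ i, Edge α β γ (α + β) (y i)) :
    completions α β γ P (α + β) y = {∅} ∧ y = fun i : Fin γ => -(β : ℤ) + (i : ℕ) := by
  have hy' := eq_of_strictMono_of_mem (b := -(β : ℤ)) hy fun i => by
    have := hE i
    unfold Edge at this
    omega
  refine ⟨?_, hy'⟩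
  ext T
  rw [Set.mem_singleton_iff]
  constructor
  · intro h
    rw [Set.eq_empty_iff_forall_notMem]
    rintro (⟨x, v⟩ | ⟨x, v⟩ | ⟨x, v⟩) hR
    · have := h.A_mem hR; omega
    · have := h.B_mem hR
      unfold Edge at this; omega
    · have := h.C_mem hR
      unfold Edge at this; omega
  · rintro rfl
    constructor
    case A_mem => exact fun h => absurd h (Set.notMem_empty _)
    case B_mem => exact fun h => absurd h (Set.notMem_empty _)
    case C_mem => exact fun h => absurd h (Set.notMem_empty _)
    case allowed => exact fun R h => absurd h (Set.notMem_empty _)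
    case sub => rintro _ ⟨i, rfl⟩; exact hE i
    case last =>
      intro _ v hv
      unfold Edge at hv
      refine ⟨⟨(v + β).toNat, by omega⟩, ?_⟩
      rw [hy']
      simp only
      omega
    case start => intro v _ h; omega
    case start_not => intro v _; simp
    case right => intro x v h1 _ h2; omega
    case left =>
      intro x v h1 h2
      unfold Edge at h2; omega

open Classical in
/-- The number of completions is a determinant of weighted numbers of lattice paths. -/
theorem ncard_completions_eq_det (hPA : ∀ x v, P (.A x v)) (f : Fin γ → ℤ → ℤ → ℤ)
    (hf : ∀ i (x v : ℤ), 0 ≤ x → x < α + β → f i x v = (if P (.B x v) then f i (x + 1) v else 0) +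
      (if P (.C x v) then f i (x + 1) (v - 1) else 0))
    (hvan : ∀ i (x v : ℤ), 0 < x → x ≤ α + β → v < -(β : ℤ) ∨ α + γ ≤ x + v → f i x v = 0)
    (hlast : (Matrix.of fun j i : Fin γ => f i (α + β) (-(β : ℤ) + (j : ℕ))).det = 1) (m : ℕ) :
    ∀ x₀ : ℤ, x₀ + m = α + β → 0 ≤ x₀ → ∀ y : Fin γ → ℤ, StrictMono y →
      (∀ i, Edge α β γ x₀ (y i)) → (completions α β γ P x₀ y).Finite ∧
        ((completions α β γ P x₀ y).ncard : ℤ) = (Matrix.of fun j i => f i x₀ (y j)).det := by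
  induction m with
  | zero =>
    intro x₀ hx hx0 y hy hE
    obtain rfl : x₀ = α + β := by omega
    obtain ⟨h1, h2⟩ := completions_last (P := P) hy hE
    rw [h1]
    refine ⟨Set.finite_singleton _, ?_⟩
    rw [Set.ncard_singleton, h2, hlast]
    rfl
  | succ m ih =>
    intro x₀ hx hx0 y hy hE
    have hxlt : x₀ < α + β := by omega
    have key : ∀ s, Function.Injective (stepHeights y s) →
        (completions α β γ P (x₀ + 1) (stepHeights y s)).Finite ∧
        ((completions α β γ P (x₀ + 1) (stepHeights y s)).ncard : ℤ) =
          (Matrix.of fun j i => f i (x₀ + 1) (stepHeights y s j)).det := by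
      intro s hs
      by_cases hE' : ∀ i, Edge α β γ (x₀ + 1) (stepHeights y s i)
      · exact ih (x₀ + 1) (by push_cast at hx; omega) (by omega) _
          ((monotone_stepHeights hy s).strictMono_of_injective hs) hE'
      -- A step leaving the hexagon has no completions; the determinant agrees, because `hvan` makes
      -- the row of the offending path zero.
      · have hem : completions α β γ P (x₀ + 1) (stepHeights y s) = ∅ := by
          rw [Set.eq_empty_iff_forall_notMem]
          exact fun T hT => hE' fun i => hT.sub _ ⟨i, rfl⟩
        rw [hem]
        refine ⟨Set.finite_empty, ?_⟩
        push Not at hE'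
        obtain ⟨j, hj⟩ := hE'
        rw [Matrix.det_eq_zero_of_row_eq_zero j]
        · simp
        · intro i
          refine hvan i _ _ (by omega) (by omega) ?_
          have h1 := hE j
          unfold Edge at h1 hj
          unfold stepHeights at hj ⊢
          split_ifs at hj ⊢ <;> omega
    obtain ⟨h1, h2⟩ := ncard_completions_succ (P := P) hxlt hx0 hy.injective hE
      fun s hs => (key s hs).1
    refine ⟨h1, ?_⟩
    rw [h2, det_step (fun i => f i x₀) (fun i => f i (x₀ + 1)) (fun v => P (.B x₀ v))
      (fun v => P (.C x₀ v)) (fun i v => hf i x₀ v hx0 hxlt) y]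
    push_cast
    refine Finset.sum_congr rfl fun s _ => ?_
    rw [forall_mem_columnTiles_iff hPA]
    split_ifs with hs
    · exact (key s hs.1).2
    · rfl

/-- The heights at the left side of the hexagon. -/
def initialHeights (γ : ℕ) (i : Fin γ) : ℤ := (i : ℕ)

theorem mem_range_initialHeights {v : ℤ} :
    v ∈ Set.range (initialHeights γ) ↔ 0 ≤ v ∧ v < γ := by
  constructor
  · rintro ⟨i, rfl⟩
    unfold initialHeights
    omega
  · rintro ⟨h1, h2⟩
    exact ⟨⟨v.toNat, by omega⟩, by simp [initialHeights, h1]⟩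

/-- All edges of the left side are starting edges, and no `A` tile can stick out to the left of it,
so the condition on right triangles in column zero is exactly `start`. -/
theorem mem_completions_initialHeights {T : Set Rhombus} :
    T ∈ completions α β γ P 0 (initialHeights γ) ↔
      IsHexagonTiling α β γ T ∧ ∀ R ∈ T, P R := by
  constructor
  · intro h
    refine ⟨⟨fun hR => h.A_mem hR, fun hR => (h.B_mem hR).2, fun hR => (h.C_mem hR).2, ?_,
      fun h1 h2 => h.left h1 h2⟩, h.allowed⟩
    intro x v hE hx
    obtain h0 | h0 := hE.1.lt_or_eq
    · exact h.right h0 hE hx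
    · subst h0
      have h1 := h.start v (mem_range_initialHeights.2 (by unfold Edge at hE; omega)) hx
      have h2 : Rhombus.A (0 - 1) (v + 1) ∉ T := fun hc => by
        have := (h.A_mem hc).1
        omega
      unfold ExactlyOne
      tauto
  · rintro ⟨h, hP⟩
    constructor
    case A_mem => exact fun hR => h.A_mem hR
    case B_mem => exact fun hR => ⟨(h.B_mem hR).1.1, h.B_mem hR⟩
    case C_mem => exact fun hR => ⟨(h.C_mem hR).1.1, h.C_mem hR⟩
    case allowed => exact hP
    case sub =>
      intro v hv
      have := mem_range_initialHeights.1 hv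
      unfold Edge
      omega
    case last =>
      intro _ v hv
      rw [mem_range_initialHeights]
      unfold Edge at hv
      omega
    case start =>
      intro v hv hx
      have hE : Edge α β γ 0 v := by
        have := mem_range_initialHeights.1 hv
        unfold Edge
        omega
      have h1 := h.right hE hx
      have h2 : Rhombus.A (0 - 1) (v + 1) ∉ T := fun hc => by
        have := (h.A_mem hc).1
        omega
      unfold ExactlyOne at h1
      tauto
    case start_not =>
      intro v hv
      rw [mem_range_initialHeights] at hv
      constructor
      · intro hc
        have := (h.B_mem hc).1
        unfold Edge at this
        omega
      · intro hc
        have := (h.C_mem hc).1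
        unfold Edge at this
        omega
    case right => exact fun _ h1 h2 => h.right h1 h2
    case left => exact fun h1 h2 => h.left h1 h2

end PathCount


/-! ### The three fixed tiles as restrictions on single tiles -/

section FixedTiles

theorem occ_of_le {occ : ℤ → Prop} {m M : ℤ}
    (mono : ∀ x, m ≤ x → x < M → occ x → occ (x + 1)) {x y : ℤ} (hm : m ≤ x) (hxy : x ≤ y)
    (hM : y ≤ M) (h : occ x) : occ y := by
  induction y, hxy using Int.leInduction with
  | base => exact h
  | succ y hy ih => exact mono y (by omega) (by omega) (ih (by omega))

/-- A monotone predicate that is false at `m` and true at `M` switches exactly once, so "it switches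
at `x₀`" is the same as "it switches nowhere else". This turns the presence of a fixed tile into a
prohibition of other tiles, which the column-by-column count can handle. -/
theorem jump_iff_forall_jump {occ : ℤ → Prop} {m M : ℤ}
    (mono : ∀ x, m ≤ x → x < M → occ x → occ (x + 1)) (hm : ¬ occ m) (hM : occ M) {x₀ : ℤ}
    (h1 : m ≤ x₀) (h2 : x₀ < M) : (¬ occ x₀ ∧ occ (x₀ + 1)) ↔
      ∀ x, m ≤ x → x < M → ¬ occ x → occ (x + 1) → x = x₀ := by
  constructor
  · rintro ⟨h3, h4⟩ x h5 h6 h7 h8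
    obtain h | h | h := lt_trichotomy x x₀
    · exact absurd (occ_of_le mono (by omega) (by omega) (by omega) h8) h3
    · exact h
    · exact absurd (occ_of_le mono (by omega) (by omega) (by omega) h4) h7
  · intro h
    have : ∃ x, m ≤ x ∧ x < M ∧ ¬ occ x ∧ occ (x + 1) := by
      by_contra hc
      push Not at hc
      have key : ∀ x, m ≤ x → x ≤ M → ¬ occ x := fun x hx => by
        induction x, hx using Int.leInduction with
        | base => exact fun _ => hm
        | succ y hy ih => exact fun h => hc y hy (by omega) (ih (by omega))
      exact key M (by omega) le_rfl hM
    obtain ⟨x, h3, h4, h5, h6⟩ := this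
    obtain rfl := h x h3 h4 h5 h6
    exact ⟨h5, h6⟩

/-- The tiles that force the paths through the three fixed tiles. -/
def Allowed (α β γ r s t : ℕ) : Rhombus → Prop
  | .A _ _ => True
  | .B x y => (x + y = α + γ - 2 → x = α + β - s - 1) ∧ (x = 0 → (γ : ℤ) - t ≤ y)
  | .C x y => (y = -(β : ℤ) + 1 → x = β + r - 1) ∧ (x = 0 → y < (γ : ℤ) - t)

variable {α β γ r s t : ℕ} {T : Set Rhombus}

theorem tileLowerRight_mem_iff (h : IsHexagonTiling α β γ T) (hβ : 0 < β) (hγ : 0 < γ)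
    (hr : r ≤ α) : tileLowerRight β r ∈ T ↔
      ∀ x, Rhombus.C x (-(β : ℤ) + 1) ∈ T → x = β + r - 1 := by
  -- `occ x` means that a path crosses the lowest edge on the line `x`. From there a `C` would leave
  -- the hexagon, so the path stays in the lowest row; the `C` tiles entering this row are the
  -- switches of `occ`.
  let occ : ℤ → Prop := fun x => Edge α β γ x (-β) ∧ Rhombus.A (x - 1) (-(β : ℤ) + 1) ∉ T
  have hB : ∀ x, occ x → x < α + β → Rhombus.B x (-(β : ℤ)) ∈ T := fun x hx hlt => by
    have h1 := h.right hx.1 hlt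
    have h2 : Rhombus.C x (-(β : ℤ)) ∉ T := fun hc => by
      have := (h.C_mem hc).2
      unfold Edge at this
      omega
    have := hx.2
    unfold ExactlyOne at h1
    tauto
  -- The range begins at β - 1, one step before the lowest corner, since a path may enter the row
  -- right at that corner (the case r = 0).
  have mono : ∀ x, (β : ℤ) - 1 ≤ x → x < α + β → occ x → occ (x + 1) := fun x h1 h2 hx => by
    have h3 := hB x hx h2
    have h4 := (h.B_mem h3).2
    have h5 := h.left (by omega) h4
    refine ⟨h4, ?_⟩
    rw [add_sub_cancel_right]
    unfold ExactlyOne at h5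
    tauto
  have hm : ¬ occ ((β : ℤ) - 1) := fun hc => by
    have := hc.1
    unfold Edge at this
    omega
  have hM : occ (α + β) := by
    refine ⟨by unfold Edge; omega, fun hc => ?_⟩
    have := h.A_mem hc
    omega
  have hD : ∀ x, (β : ℤ) - 1 ≤ x → x < α + β →
      (Rhombus.C x (-(β : ℤ) + 1) ∈ T ↔ ¬ occ x ∧ occ (x + 1)) := fun x h1 h2 => by
    constructor
    · intro hC
      have h3 := (h.C_mem hC).2
      rw [add_sub_cancel_right] at h3
      have h4 := h.left (by omega) h3
      unfold ExactlyOne at h4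
      refine ⟨fun ho => ?_, h3, ?_⟩
      · have := hB x ho h2
        tauto
      · rw [add_sub_cancel_right]
        tauto
    · rintro ⟨h3, h4, h5⟩
      rw [add_sub_cancel_right] at h5
      have h6 := h.left (by omega) h4
      have h7 : Rhombus.B x (-(β : ℤ)) ∉ T := fun hc => by
        have h8 := (h.B_mem hc).1
        have h9 := h.right h8 h2
        refine h3 ⟨h8, ?_⟩
        unfold ExactlyOne at h9
        tauto
      unfold ExactlyOne at h6
      tauto
  have hx0 : (β : ℤ) - 1 ≤ β + r - 1 ∧ (β : ℤ) + r - 1 < α + β := by omega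
  unfold tileLowerRight
  rw [hD _ hx0.1 hx0.2, jump_iff_forall_jump mono hm hM hx0.1 hx0.2]
  constructor
  · intro H x hx
    have h1 := h.C_mem hx
    unfold Edge at h1
    have h2 : (β : ℤ) - 1 ≤ x ∧ x < α + β := by omega
    have h3 := (hD x h2.1 h2.2).1 hx
    exact H x h2.1 h2.2 h3.1 h3.2
  · exact fun H x h1 h2 h3 h4 => H x ((hD x h1 h2).2 ⟨h3, h4⟩)

theorem tileUpperRight_mem_iff (h : IsHexagonTiling α β γ T) (hα : 0 < α) (hγ : 0 < γ)
    (hs : s ≤ β) : tileUpperRight α β γ s ∈ T ↔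
      ∀ x y, Rhombus.B x y ∈ T → x + y = α + γ - 2 → x = α + β - s - 1 := by
  -- Now the row is x + y = α + γ - 1 along the upper right side: a `C` stays in it, a `B` would
  -- leave the hexagon, and it is entered by a `B`.
  let occ : ℤ → Prop := fun x =>
    Edge α β γ x (α + γ - 1 - x) ∧ Rhombus.A (x - 1) (α + γ - 1 - x + 1) ∉ T
  have hC : ∀ x, occ x → x < α + β → Rhombus.C x (α + γ - 1 - x) ∈ T := fun x hx hlt => by
    have h1 := h.right hx.1 hlt
    have h2 : Rhombus.B x (α + γ - 1 - x) ∉ T := fun hc => by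
      have := (h.B_mem hc).2
      unfold Edge at this
      omega
    exact h1.1.resolve_left h2 |>.resolve_right hx.2
  have e1 : ∀ x : ℤ, (α : ℤ) + γ - 1 - (x + 1) = α + γ - 2 - x := fun x => by ring
  have e2 : ∀ x : ℤ, (α : ℤ) + γ - 2 - x + 1 = α + γ - 1 - x := fun x => by ring
  have e3 : ∀ x : ℤ, (α : ℤ) + γ - 1 - x - 1 = α + γ - 2 - x := fun x => by ring
  have mono : ∀ x, (α : ℤ) - 1 ≤ x → x < α + β → occ x → occ (x + 1) := fun x h1 h2 hx => by
    have h3 := hC x hx h2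
    have h4 := (h.C_mem h3).2
    rw [e3] at h4
    have h5 := h.left (by omega) h4
    unfold occ
    rw [add_sub_cancel_right, e1, e2]
    rw [e2] at h5
    exact ⟨h4, fun hc => h5.2.2.2 ⟨h3, hc⟩⟩
  have hm : ¬ occ ((α : ℤ) - 1) := fun hc => by
    have := hc.1
    unfold Edge at this
    omega
  have hM : occ (α + β) := by
    refine ⟨by unfold Edge; omega, fun hc => ?_⟩
    have := h.A_mem hc
    omega
  have hD : ∀ x, (α : ℤ) - 1 ≤ x → x < α + β →
      (Rhombus.B x (α + γ - 2 - x) ∈ T ↔ ¬ occ x ∧ occ (x + 1)) := fun x h1 h2 => by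
    have hocc : occ (x + 1) ↔
        Edge α β γ (x + 1) (α + γ - 2 - x) ∧ Rhombus.A x (α + γ - 1 - x) ∉ T := by
      unfold occ
      rw [add_sub_cancel_right, e1, e2]
    rw [hocc]
    constructor
    · intro hB
      have h3 := (h.B_mem hB).2
      have h4 := h.left (by omega) h3
      rw [e2] at h4
      exact ⟨fun ho => h4.2.1 ⟨hB, hC x ho h2⟩, h3, fun hc => h4.2.2.1 ⟨hB, hc⟩⟩
    · rintro ⟨h3, h4, h5⟩
      have h6 := h.left (by omega) h4
      rw [e2] at h6
      have h7 : Rhombus.C x (α + γ - 1 - x) ∉ T := fun hc => by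
        have h8 := (h.C_mem hc).1
        have h9 := h.right h8 h2
        exact h3 ⟨h8, fun hA => h9.2.2.2 ⟨hc, hA⟩⟩
      exact h6.1.resolve_right (not_or.2 ⟨h7, h5⟩)
  have hx0 : (α : ℤ) - 1 ≤ α + β - s - 1 ∧ (α : ℤ) + β - s - 1 < α + β := by omega
  unfold tileUpperRight
  rw [show (γ : ℤ) - β + s - 1 = α + γ - 2 - (α + β - s - 1) by ring,
    hD _ hx0.1 hx0.2, jump_iff_forall_jump mono hm hM hx0.1 hx0.2]
  constructor
  · intro H x y hx hxy
    have h1 := h.B_mem hx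
    unfold Edge at h1
    have h2 : (α : ℤ) - 1 ≤ x ∧ x < α + β := by omega
    obtain rfl : y = α + γ - 2 - x := by omega
    have h3 := (hD x h2.1 h2.2).1 hx
    exact H x h2.1 h2.2 h3.1 h3.2
  · exact fun H x h1 h2 h3 h4 => H x _ ((hD x h1 h2).2 ⟨h3, h4⟩) (by ring)

theorem tileLeft_mem_iff (h : IsHexagonTiling α β γ T) (hα : 0 < α) (hβ : 0 < β)
    (ht : t ≤ γ) : tileLeft γ t ∈ T ↔
      (∀ y, Rhombus.B 0 y ∈ T → (γ : ℤ) - t ≤ y) ∧ ∀ y, Rhombus.C 0 y ∈ T → y < (γ : ℤ) - t := by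
  -- Here the switch runs along the left side: above a path that starts with `B`, no path can start
  -- with `C`, since both would reach the same edge. Hence the initial `C` steps lie below the
  -- initial `B` steps.
  let occ : ℤ → Prop := fun y => 0 ≤ y ∧ Rhombus.C 0 y ∉ T
  have hB : ∀ y : ℤ, 0 ≤ y → y < γ →
      (.B 0 y ∈ T ∨ .C 0 y ∈ T) ∧ ¬(.B 0 y ∈ T ∧ .C 0 y ∈ T) := fun y h1 h2 => by
    have h3 := h.right (x := 0) (y := y) (by unfold Edge; omega) (by omega)
    have h4 : Rhombus.A (0 - 1) (y + 1) ∉ T := fun hc => by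
      have := h.A_mem hc
      omega
    unfold ExactlyOne at h3
    tauto
  have mono : ∀ y, -1 ≤ y → y < (γ : ℤ) → occ y → occ (y + 1) := fun y h1 h2 hy => by
    have h3 : Rhombus.B 0 y ∈ T := by
      have := hB y hy.1 h2
      have := hy.2
      tauto
    have h4 := h.left le_rfl (h.B_mem h3).2
    have := hy.1
    refine ⟨by omega, ?_⟩
    unfold ExactlyOne at h4
    tauto
  unfold tileLeft
  set y₀ : ℤ := γ - t - 1 with hy₀
  rw [show (γ : ℤ) - t = y₀ + 1 by omega]
  have hE : Edge α β γ (0 + 1) y₀ := by unfold Edge; omega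
  have hl := h.left le_rfl hE
  constructor
  · intro hA
    have h1 : ¬ occ y₀ := fun ho => by
      have := hB y₀ ho.1 (by omega)
      have := ho.2
      unfold ExactlyOne at hl
      tauto
    have h2 : occ (y₀ + 1) := by
      refine ⟨by omega, ?_⟩
      unfold ExactlyOne at hl
      tauto
    constructor
    · intro y hy
      have h3 := (h.B_mem hy).1
      unfold Edge at h3
      have h4 := hB y (by omega) (by omega)
      by_contra hc
      exact h1 (occ_of_le mono (x := y) (by omega) (by omega) (by omega)
        ⟨by omega, fun h5 => h4.2 ⟨hy, h5⟩⟩)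
    · intro y hy
      have h3 := (h.C_mem hy).1
      unfold Edge at h3
      by_contra hc
      exact (occ_of_le mono (y := y) (by omega) (by omega) (by omega) h2).2 hy
  · rintro ⟨h1, h2⟩
    have h3 : Rhombus.B 0 y₀ ∉ T := fun hc => by
      have := h1 _ hc
      omega
    have h4 : Rhombus.C 0 (y₀ + 1) ∉ T := fun hc => by
      have := h2 _ hc
      omega
    unfold ExactlyOne at hl
    tauto

theorem mem_tiles_iff_forall_allowed (h : IsHexagonTiling α β γ T) (hα : 0 < α) (hβ : 0 < β)
    (hγ : 0 < γ) (hr : r ≤ α) (hs : s ≤ β) (ht : t ≤ γ) :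
    (tileLowerRight β r ∈ T ∧ tileUpperRight α β γ s ∈ T ∧ tileLeft γ t ∈ T) ↔
      ∀ R ∈ T, Allowed α β γ r s t R := by
  rw [tileLowerRight_mem_iff h hβ hγ hr, tileUpperRight_mem_iff h hα hγ hs,
    tileLeft_mem_iff h hα hβ ht]
  constructor
  · rintro ⟨h1, h2, h3, h4⟩ (⟨x, y⟩ | ⟨x, y⟩ | ⟨x, y⟩) hR
    · trivial
    · exact ⟨h2 x y hR, by rintro rfl; exact h3 y hR⟩
    · exact ⟨by rintro rfl; exact h1 x hR, by rintro rfl; exact h4 y hR⟩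
  · intro H
    exact ⟨fun x hx => (H _ hx).1 rfl, fun x y hx => (H _ hx).1, fun y hy => (H _ hy).2 rfl,
      fun y hy => (H _ hy).2 rfl⟩

theorem tilings_eq_completions (a b c : ℕ) (hr : r ≤ a + 2) (hs : s ≤ b + 2) (ht : t ≤ c + 2) :
    tilings a b c r s t = completions (a + 2) (b + 2) (c + 2)
      (Allowed (a + 2) (b + 2) (c + 2) r s t) 0 (initialHeights (c + 2)) := by
  ext T
  rw [mem_completions_initialHeights, tilings, Set.mem_ofPred_eq, isTiling_hexagon_iff]
  exact and_congr_right fun h =>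
    mem_tiles_iff_forall_allowed h (by omega) (by omega) (by omega) hr hs ht

end FixedTiles


/-! ### Explicit path counts -/

/-- The binomial coefficient with integer arguments, zero if one of them is negative. -/
def binom (m k : ℤ) : ℤ := if 0 ≤ m ∧ 0 ≤ k then (m.toNat.choose k.toNat : ℤ) else 0

theorem binom_eq_zero {m k : ℤ} (h : m < 0 ∨ k < 0 ∨ m < k) : binom m k = 0 := by
  unfold binom
  split_ifs with h1
  · rw [Nat.choose_eq_zero_of_lt (by omega), Nat.cast_zero]
  · rfl

theorem binom_zero_right {m : ℤ} (h : 0 ≤ m) : binom m 0 = 1 := by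
  simp [binom, h]

theorem binom_self {m : ℤ} (h : 0 ≤ m) : binom m m = 1 := by
  simp [binom, h]

theorem binom_natCast (m k : ℕ) : binom m k = m.choose k := by
  simp [binom]

/-- The case m = 0 has to be left out: `binom 0 0 = 1`, but both terms on the right would vanish.
The single steps into the lowest and highest rows are located exactly where this happens. -/
theorem binom_eq_add {m k : ℤ} (h : 1 ≤ m) :
    binom m k = binom (m - 1) k + binom (m - 1) (k - 1) := by
  obtain h0 | rfl | h0 := lt_trichotomy k 0
  · rw [binom_eq_zero (.inr (.inl h0)), binom_eq_zero (.inr (.inl h0)),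
      binom_eq_zero (.inr (.inl (by omega))), add_zero]
  · rw [binom_zero_right (by omega), binom_zero_right (by omega),
      binom_eq_zero (.inr (.inl (by omega))), add_zero]
  · lift m to ℕ using by omega
    lift k to ℕ using by omega
    obtain ⟨m, rfl⟩ : ∃ m', m = m' + 1 := ⟨m - 1, by omega⟩
    obtain ⟨k, rfl⟩ : ∃ k', k = k' + 1 := ⟨k - 1, by omega⟩
    rw [binom_natCast]
    push_cast
    rw [add_sub_cancel_right, add_sub_cancel_right, binom_natCast,
      show (k : ℤ) + 1 = ((k + 1 : ℕ) : ℤ) by push_cast; ring, binom_natCast,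
      Nat.choose_succ_succ]
    push_cast
    ring

section PathCount

/-- The number of paths from height `v` on the line `x > 0` to the lowest endpoint. -/
def lowPaths (β r : ℕ) (x v : ℤ) : ℤ :=
  (if v = -β then 1 else 0) + binom (β + r - 1 - x) (v + β - 1)

/-- The number of paths from height `v` on the line `x > 0` to the highest endpoint. -/
def topPaths (α β γ s : ℕ) (x v : ℤ) : ℤ :=
  (if x + v = α + γ - 1 then 1 else 0) +
    binom (α + β - s - 1 - x) (v - (γ - β + s - 1))

/-- The number of paths from height `v` on the line `x > 0` to the endpoint with index `i`, where
the endpoint has been moved horizontally by `γ - 2 - i`. -/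
def midPaths (α β γ : ℕ) (i : ℕ) (x v : ℤ) : ℤ :=
  binom (α + β - x + γ - 2 - i) (v + β - i)

variable {α β γ r s : ℕ} {i : ℕ} {x v : ℤ}

theorem lowPaths_eq_zero (hr : r ≤ α) (hγ : 2 ≤ γ) (hx' : x ≤ α + β)
    (h : v < -(β : ℤ) ∨ α + γ ≤ x + v) :
    lowPaths β r x v = 0 := by
  unfold lowPaths
  rw [if_neg (by omega), binom_eq_zero (by omega), add_zero]

theorem topPaths_eq_zero (hγ : 2 ≤ γ) (hx' : x ≤ α + β)
    (h : v < -(β : ℤ) ∨ α + γ ≤ x + v) :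
    topPaths α β γ s x v = 0 := by
  unfold topPaths
  rw [if_neg (by omega), binom_eq_zero (by omega), add_zero]

theorem midPaths_eq_zero (hi0 : 0 < i)
    (h : v ≤ -(β : ℤ) ∨ α + γ ≤ x + v + 1) : midPaths α β γ i x v = 0 := by
  unfold midPaths
  rw [binom_eq_zero (by omega)]

-- The restrictions only concern steps into the lowest or the highest row, where the middle counts
-- are zero anyway; what remains is Pascal's rule.
open Classical in
theorem midPaths_eq_add (hi0 : 0 < i) (hi : i + 1 < γ) (hx : x < α + β) {p q : Prop}
    (hp : x + v ≠ α + γ - 2 → p) (hq : v ≠ -(β : ℤ) + 1 → q) :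
    midPaths α β γ i x v = (if p then midPaths α β γ i (x + 1) v else 0) +
      (if q then midPaths α β γ i (x + 1) (v - 1) else 0) := by
  have h1 : (if p then midPaths α β γ i (x + 1) v else 0) = midPaths α β γ i (x + 1) v := by
    split_ifs with h
    · rfl
    · rw [midPaths_eq_zero hi0]
      have := mt hp h
      omega
  have h2 : (if q then midPaths α β γ i (x + 1) (v - 1) else 0) =
      midPaths α β γ i (x + 1) (v - 1) := by
    split_ifs with h
    · rfl
    · rw [midPaths_eq_zero hi0]
      have := mt hq h
      omega
  rw [h1, h2]
  unfold midPaths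
  rw [binom_eq_add (by omega)]
  congr 2 <;> ring

-- Away from height -β+1 this is Pascal's rule. At that height the only step into the lowest row is
-- the one at x = β+r-1, where the indicator term takes over from the binomial coefficient. The
-- restriction at the top is void, as the count is zero there.
open Classical in
theorem lowPaths_eq_add (hr : r ≤ α) (hγ : 2 ≤ γ) (hx : x < α + β) {p q : Prop}
    (hp : x + v ≠ α + γ - 2 → p) (hq : q ↔ (v = -(β : ℤ) + 1 → x = β + r - 1)) :
    lowPaths β r x v = (if p then lowPaths β r (x + 1) v else 0) +
      (if q then lowPaths β r (x + 1) (v - 1) else 0) := by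
  have h1 : (if p then lowPaths β r (x + 1) v else 0) = lowPaths β r (x + 1) v := by
    split_ifs with h
    · rfl
    · have := mt hp h
      unfold lowPaths
      rw [if_neg (by omega), binom_eq_zero (by omega), add_zero]
  rw [h1, if_congr hq rfl rfl]
  clear h1 hp hq
  unfold lowPaths
  by_cases hv : v = -(β : ℤ) + 1
  · subst hv
    rw [if_neg (c := -(β : ℤ) + 1 = -β) (by omega), if_pos (c := -(β : ℤ) + 1 - 1 = -β) (by ring)]
    rw [show -(β : ℤ) + 1 + β - 1 = 0 by ring, binom_eq_zero (k := _ - 1 + _ - 1) (by omega)]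
    -- At x = β+r-1 the fixed tile is used; further left the path must walk horizontally to it,
    -- further right it has missed it.
    by_cases h0 : x = β + r - 1
    · rw [if_pos (fun _ => h0), binom_zero_right (by omega), binom_eq_zero (by omega)]
      rfl
    · rw [if_neg (by simpa using h0)]
      obtain h2 | h2 := lt_or_gt_of_ne h0
      · rw [binom_zero_right (by omega), binom_zero_right (by omega)]
        rfl
      · rw [binom_eq_zero (by omega), binom_eq_zero (by omega)]
        rfl
  · rw [if_pos (c := _ → _) (fun h => absurd h hv), if_neg (c := v - 1 = _) (by omega)]
    by_cases h0 : x = β + r - 1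
    · rw [binom_eq_zero (m := _ - 1 - x) (by omega),
        binom_eq_zero (by omega), binom_eq_zero (by omega)]
      ring
    · obtain h2 | h2 := lt_or_gt_of_ne h0
      · rw [binom_eq_add (by omega), show (β : ℤ) + r - 1 - x - 1 = β + r - 1 - (x + 1) by ring,
          show v + β - 1 - 1 = v - 1 + β - 1 by ring]
        ring
      · rw [binom_eq_zero (m := _ - 1 - x) (by omega),
          binom_eq_zero (by omega), binom_eq_zero (by omega)]
        ring

-- The mirror image of the recursion for the lowest endpoint: the row x + v = α+γ-2 can only be left
-- upwards at x = α+β-s-1.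
open Classical in
theorem topPaths_eq_add (hγ : 2 ≤ γ) (hx : x < α + β) {p q : Prop}
    (hp : p ↔ (x + v = α + γ - 2 → x = α + β - s - 1)) (hq : v ≠ -(β : ℤ) + 1 → q) :
    topPaths α β γ s x v = (if p then topPaths α β γ s (x + 1) v else 0) +
      (if q then topPaths α β γ s (x + 1) (v - 1) else 0) := by
  have h1 : (if q then topPaths α β γ s (x + 1) (v - 1) else 0) =
      topPaths α β γ s (x + 1) (v - 1) := by
    split_ifs with h
    · rfl
    · have := mt hq h
      unfold topPaths
      rw [if_neg (by omega), binom_eq_zero (by omega), add_zero]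
  rw [h1, if_congr hp rfl rfl]
  clear h1 hp hq
  unfold topPaths
  by_cases hv : x + v = α + γ - 2
  · rw [if_neg (by omega), if_pos (c := x + 1 + v = _) (by omega),
      if_neg (c := x + 1 + (v - 1) = _) (by omega)]
    by_cases h0 : x = α + β - s - 1
    · rw [if_pos (fun _ => h0), show v - (γ - β + s - 1) = α + β - s - 1 - x by omega,
        binom_self (by omega), binom_eq_zero (by omega), binom_eq_zero (by omega)]
      rfl
    · rw [if_neg (by simpa [hv] using h0)]
      obtain h2 | h2 := lt_or_gt_of_ne h0
      · rw [show v - (γ - β + s - 1) = α + β - s - 1 - x by omega,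
          show v - 1 - (γ - β + s - 1) = α + β - s - 1 - (x + 1) by omega,
          binom_self (by omega), binom_self (by omega)]
        rfl
      · rw [binom_eq_zero (by omega), binom_eq_zero (by omega)]
        rfl
  · rw [if_pos (c := _ → _) (fun h => absurd h hv), if_neg (c := x + 1 + v = _) (by omega)]
    have hxv : x + 1 + (v - 1) = (α : ℤ) + γ - 1 ↔ x + v = α + γ - 1 := by
      rw [show x + 1 + (v - 1) = x + v by ring]
    simp only [hxv]
    by_cases h0 : x < α + β - s - 1
    · rw [binom_eq_add (by omega),
        show (α : ℤ) + β - s - 1 - x - 1 = α + β - s - 1 - (x + 1) by ring,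
        show v - (γ - β + s - 1) - 1 = v - 1 - (γ - β + s - 1) by ring]
      ring
    · rw [binom_eq_zero (m := _ - 1 - x) (by omega),
        binom_eq_zero (by omega), binom_eq_zero (by omega)]
      ring

/-- The weighted number of paths from height `v` on the line `x > 0` to the endpoint `i`. -/
def pathCount (α β γ r s : ℕ) (i : Fin γ) (x v : ℤ) : ℤ :=
  if (i : ℕ) = 0 then lowPaths β r x v
  else if (i : ℕ) + 1 = γ then topPaths α β γ s x v
  else midPaths α β γ i x v

theorem pathCount_eq_zero (hr : r ≤ α) (hγ : 2 ≤ γ) (hx' : x ≤ α + β)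
    (h : v < -(β : ℤ) ∨ α + γ ≤ x + v) (i : Fin γ) : pathCount α β γ r s i x v = 0 := by
  unfold pathCount
  split_ifs with h1 h2
  · exact lowPaths_eq_zero hr hγ hx' h
  · exact topPaths_eq_zero hγ hx' h
  · exact midPaths_eq_zero (by omega) (by omega)

/-- Moving the middle endpoints replaces the identity matrix by a unitriangular one with middle
entries C(γ-2-i, j-i), so the determinant still counts the tilings. -/
theorem det_pathCount_last : (Matrix.of fun j i : Fin γ =>
    pathCount α β γ r s i (α + β) (-(β : ℤ) + (j : ℕ))).det = 1 := by
  have hdiag : ∀ i : Fin γ, pathCount α β γ r s i (α + β) (-(β : ℤ) + (i : ℕ)) = 1 := by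
    intro i
    unfold pathCount lowPaths topPaths midPaths
    split_ifs with h1 h2 h3 h4
    · rw [binom_eq_zero (by omega)]; rfl
    · omega
    · rw [binom_eq_zero (by omega)]; rfl
    · omega
    · rw [show -(β : ℤ) + (i : ℕ) + β - (i : ℕ) = 0 by ring, binom_zero_right (by omega)]
  rw [Matrix.det_of_isLowerTriangular]
  · exact Finset.prod_eq_one fun i _ => hdiag i
  · intro j i hij
    have hij' : (j : ℕ) < i := hij
    simp only [Matrix.of_apply]
    unfold pathCount lowPaths topPaths midPaths
    split_ifs with h1 h2 h3 h4
    · omega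
    · omega
    · omega
    · rw [binom_eq_zero (by omega)]; rfl
    · rw [binom_eq_zero (by omega)]

end PathCount

open Classical in
theorem ncard_tilings_eq_det {a b c r s t : ℕ} (hr : r ≤ a + 2) (hs : s ≤ b + 2)
    (ht : t ≤ c + 2) : (tilings a b c r s t).Finite ∧
    ((tilings a b c r s t).ncard : ℤ) = (Matrix.of fun j i : Fin (c + 2) =>
      pathCount (a + 2) (b + 2) (c + 2) r s i 1
        (if (j : ℕ) < c + 2 - t then (j : ℤ) - 1 else j)).det := by
  rw [tilings_eq_completions a b c hr hs ht]
  set P := Allowed (a + 2) (b + 2) (c + 2) r s t with hP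
  let q := pathCount (a + 2) (b + 2) (c + 2) r s
  -- The counts `q` ignore the restriction on the first column, so their values at x = 0 are defined
  -- by one step of the recursion.
  let f : Fin (c + 2) → ℤ → ℤ → ℤ := fun i x v => if x = 0 then
    (if P (.B x v) then q i (x + 1) v else 0) + (if P (.C x v) then q i (x + 1) (v - 1) else 0)
    else q i x v
  have hf : ∀ i (x v : ℤ), 0 ≤ x → x < (a + 2 : ℕ) + (b + 2 : ℕ) →
      f i x v = (if P (.B x v) then f i (x + 1) v else 0) +
        (if P (.C x v) then f i (x + 1) (v - 1) else 0) := by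
    intro i x v hx0 hx
    by_cases h0 : x = 0
    · subst h0
      simp only [f, if_true, zero_add, one_ne_zero, if_false]
    · simp only [f, h0, if_false, show x + 1 ≠ 0 by omega]
      have hB : P (.B x v) ↔ (x + v = (a + 2 : ℕ) + (c + 2 : ℕ) - 2 →
          x = (a + 2 : ℕ) + (b + 2 : ℕ) - s - 1) := by
        simp only [hP, Allowed, h0, false_imp_iff, and_true]
      have hC : P (.C x v) ↔ (v = -((b + 2 : ℕ) : ℤ) + 1 → x = (b + 2 : ℕ) + r - 1) := by
        simp only [hP, Allowed, h0, false_imp_iff, and_true]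
      simp only [q, pathCount]
      by_cases h1 : (i : ℕ) = 0
      · simp only [h1, if_true]
        exact lowPaths_eq_add hr (by omega) hx (fun h => hB.2 fun h' => absurd h' h) hC
      by_cases h2 : (i : ℕ) + 1 = c + 2
      · simp only [h1, h2, if_true, if_false]
        exact topPaths_eq_add (by omega) hx hB (fun h => hC.2 fun h' => absurd h' h)
      · simp only [h1, h2, if_false]
        exact midPaths_eq_add (by omega) (by omega) hx (fun h => hB.2 fun h' => absurd h' h)
          (fun h => hC.2 fun h' => absurd h' h)
  have hvan : ∀ i (x v : ℤ), 0 < x → x ≤ (a + 2 : ℕ) + (b + 2 : ℕ) →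
      v < -((b + 2 : ℕ) : ℤ) ∨ (a + 2 : ℕ) + (c + 2 : ℕ) ≤ x + v → f i x v = 0 := by
    intro i x v hx0 hx hv
    simp only [f, hx0.ne', if_false]
    exact pathCount_eq_zero hr (by omega) hx hv i
  have hlast : (Matrix.of fun j i : Fin (c + 2) =>
      f i ((a + 2 : ℕ) + (b + 2 : ℕ)) (-((b + 2 : ℕ) : ℤ) + (j : ℕ))).det = 1 := by
    have : ((a + 2 : ℕ) : ℤ) + (b + 2 : ℕ) ≠ 0 := by positivity
    simp only [f, this, if_false]
    exact det_pathCount_last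
  have hE : ∀ i, Edge (a + 2) (b + 2) (c + 2) 0 (initialHeights (c + 2) i) := by
    intro i
    have := i.isLt
    unfold Edge initialHeights
    omega
  obtain ⟨h1, h2⟩ := ncard_completions_eq_det (P := P) (fun _ _ => trivial) f hf hvan hlast
    (a + b + 4) 0 (by push_cast; ring) le_rfl (initialHeights (c + 2))
    (fun i j h => by simpa [initialHeights] using h) hE
  refine ⟨h1, h2.trans (congrArg Matrix.det (Matrix.ext fun j i => ?_))⟩
  simp only [Matrix.of_apply, f, if_true, zero_add]
  have hj := j.isLt
  -- On the left side the heights lie between 0 and c+1, so the conditions from the two slanted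
  -- sides are void and the fixed tile decides the first step.
  have hB : P (.B 0 (initialHeights (c + 2) j)) ↔ ¬ (j : ℕ) < c + 2 - t := by
    simp only [hP, Allowed, initialHeights]
    push_cast
    rw [true_imp_iff]
    omega
  have hC : P (.C 0 (initialHeights (c + 2) j)) ↔ (j : ℕ) < c + 2 - t := by
    simp only [hP, Allowed, initialHeights]
    push_cast
    rw [true_imp_iff]
    omega
  by_cases hjt : (j : ℕ) < c + 2 - t
  · rw [if_neg (by rw [hB]; exact not_not.2 hjt), if_pos (hC.2 hjt), if_pos hjt, zero_add]
    rfl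
  · rw [if_pos (hB.2 hjt), if_neg (by rwa [hC]), if_neg hjt, add_zero]
    rfl


/-! ### Finite differences of binomial coefficients -/

section AlternatingSums

open Finset Nat

/-- This is the m-th difference of C(·, q): every difference lowers q by one, by Pascal's rule. -/
theorem sum_alternating_choose_mul_choose_add (m : ℕ) : ∀ L q : ℕ,
    ∑ i ∈ range (m + 1), (-1 : ℚ) ^ i * m.choose i * ((L + i).choose q : ℚ) =
      (-1) ^ m * if m ≤ q then (L.choose (q - m) : ℚ) else 0 := by
  induction m with
  | zero => simp
  | succ m ih =>
    intro L q
    have hstep : ∑ i ∈ range (m + 1 + 1),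
        (-1 : ℚ) ^ i * (m + 1).choose i * ((L + i).choose q : ℚ) =
        ∑ i ∈ range (m + 1), (-1 : ℚ) ^ i * m.choose i * ((L + i).choose q : ℚ) -
        ∑ i ∈ range (m + 1), (-1 : ℚ) ^ i * m.choose i * ((L + 1 + i).choose q : ℚ) := by
      rw [sum_range_succ' _ (m + 1)]
      have h1 : ∀ i, (-1 : ℚ) ^ (i + 1) * (m + 1).choose (i + 1) * ((L + (i + 1)).choose q : ℚ) =
          (-1 : ℚ) ^ (i + 1) * m.choose (i + 1) * ((L + (i + 1)).choose q : ℚ) -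
          (-1 : ℚ) ^ i * m.choose i * ((L + 1 + i).choose q : ℚ) := fun i => by
        rw [Nat.choose_succ_succ, show L + (i + 1) = L + 1 + i by ring]
        push_cast
        ring
      simp only [h1, sum_sub_distrib]
      have h2 := sum_range_succ' (fun i => (-1 : ℚ) ^ i * m.choose i * ((L + i).choose q : ℚ))
        (m + 1)
      rw [sum_range_succ, Nat.choose_succ_self] at h2
      simp only [Nat.choose_zero_right, Nat.cast_zero, mul_zero, zero_mul] at h2 ⊢
      linarith
    rw [hstep, ih, ih]
    split_ifs with h1 h2 h2
    · obtain ⟨p, rfl⟩ : ∃ p, q = m + 1 + p := ⟨q - (m + 1), by omega⟩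
      rw [show m + 1 + p - m = p + 1 by omega, show m + 1 + p - (m + 1) = p by omega,
        Nat.choose_succ_succ]
      push_cast
      ring
    · obtain rfl : q = m := by omega
      simp
    · omega
    · simp

theorem sum_alternating_choose_mul_choose_sub {m K : ℕ} (hK : m ≤ K) (q : ℕ) :
    ∑ i ∈ range (m + 1), (-1 : ℚ) ^ i * m.choose i * ((K - i).choose q : ℚ) =
      if m ≤ q then ((K - m).choose (q - m) : ℚ) else 0 := by
  have h := sum_alternating_choose_mul_choose_add m (K - m) q
  rw [← sum_range_reflect] at h
  have h2 : ∀ i ∈ range (m + 1), (-1 : ℚ) ^ (m + 1 - 1 - i) * m.choose (m + 1 - 1 - i) *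
      ((K - m + (m + 1 - 1 - i)).choose q : ℚ) =
      (-1) ^ m * ((-1 : ℚ) ^ i * m.choose i * ((K - i).choose q : ℚ)) := by
    intro i hi
    have hi' : i ≤ m := by rw [mem_range] at hi; omega
    rw [show m + 1 - 1 - i = m - i by omega, Nat.choose_symm hi',
      show K - m + (m - i) = K - i by omega]
    have : (-1 : ℚ) ^ m = (-1) ^ (m - i) * (-1) ^ i := by
      rw [← pow_add, Nat.sub_add_cancel hi']
    rw [this]
    have h3 : ((-1 : ℚ) ^ i) * (-1) ^ i = 1 := by rw [← mul_pow]; simp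
    linear_combination -((-1 : ℚ) ^ (m - i) * m.choose i * ((K - i).choose q : ℚ)) * h3
  rw [sum_congr rfl h2, ← mul_sum] at h
  exact mul_left_cancel₀ (pow_ne_zero _ (by norm_num)) h

/-- Absorption: C(m+j, k) times the falling factorial of k of length j is C(m, k-j) times a factor
independent of k. The order of the difference drops by j. -/
theorem sum_alternating_choose_mul_descFactorial (m j : ℕ) (h : ℕ → ℚ) :
    ∑ k ∈ range (m + j + 1), (-1 : ℚ) ^ k * (m + j).choose k * h k * (k.descFactorial j : ℚ) =
      (-1) ^ j * ((m + j).descFactorial j : ℚ) *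
        ∑ i ∈ range (m + 1), (-1 : ℚ) ^ i * m.choose i * h (i + j) := by
  rw [show m + j + 1 = j + (m + 1) by ring, sum_range_add, sum_eq_zero, zero_add, mul_sum]
  · refine sum_congr rfl fun i _ => ?_
    have h1 : (m + j).choose (j + i) * (j + i).descFactorial j =
        (m + j).descFactorial j * m.choose i := by
      rw [Nat.descFactorial_eq_factorial_mul_choose, Nat.descFactorial_eq_factorial_mul_choose,
        mul_left_comm, Nat.choose_mul (Nat.le_add_right j i), Nat.add_sub_cancel,
        Nat.add_sub_cancel_left]
      ring
    have h1' : ((m + j).choose (j + i) : ℚ) * ((j + i).descFactorial j : ℚ) =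
        ((m + j).descFactorial j : ℚ) * m.choose i := by exact_mod_cast h1
    rw [pow_add, add_comm i j]
    linear_combination (-1 : ℚ) ^ j * (-1) ^ i * h (j + i) * h1'
  · intro k hk
    rw [Nat.descFactorial_of_lt (mem_range.1 hk)]
    simp

theorem choose_sub_mul_factorial_mul_factorial {r r' a j j' : ℕ} (h : r + r' = a + j + j') :
    (if j' ≤ r' then (a.choose (r' - j') : ℚ) else 0) * (r ! * r' !) =
      a ! * (r.descFactorial j * r'.descFactorial j') := by
  split_ifs with h1
  · by_cases h2 : j ≤ r
    · obtain ⟨u, rfl⟩ := Nat.exists_eq_add_of_le' h1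
      obtain ⟨v, rfl⟩ := Nat.exists_eq_add_of_le' h2
      obtain rfl : a = u + v := by omega
      have e1 := Nat.factorial_mul_descFactorial h1
      have e2 := Nat.factorial_mul_descFactorial h2
      have e3 := Nat.add_choose_mul_factorial_mul_factorial v u
      rw [add_comm v u] at e3
      rw [Nat.add_sub_cancel] at e1 e2 ⊢
      rw [← e1, ← e2, ← e3]
      push_cast
      ring
    · rw [Nat.choose_eq_zero_of_lt (by omega), Nat.descFactorial_of_lt (by omega)]
      simp
  · rw [Nat.descFactorial_of_lt (n := r') (by omega)]
    simp

end AlternatingSums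


/-! ### Entries of the matrix after clearing denominators -/

open Finset Nat

/-- If x ≤ A, then A - x = y - d, so both sides are A! y! / (y-d)!. With x = k+b and y = a+c+2-k,
the same factor x! y! serves every row of the path matrix. -/
theorem choose_mul_factorials {A d x y : ℕ} (h : A + d = x + y) :
    A.choose x * (x ! * y !) = A ! * d ! * y.choose d := by
  by_cases hx : x ≤ A
  · obtain ⟨z, rfl⟩ := Nat.exists_eq_add_of_le' hx
    obtain rfl : y = z + d := by omega
    rw [← Nat.add_choose_mul_factorial_mul_factorial z x,
      ← Nat.add_choose_mul_factorial_mul_factorial z d]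
    ring
  · rw [Nat.choose_eq_zero_of_lt (by omega), Nat.choose_eq_zero_of_lt (by omega)]
    simp

theorem binom_sub_mul_factorials {A d x y : ℕ} (h : A + d = x + y) :
    binom A ((x : ℤ) - d) * (x ! * y !) = A ! * d ! * x.choose d := by
  have h1 : binom A ((x : ℤ) - d) = A.choose y := by
    by_cases hd : d ≤ x
    · rw [← Nat.cast_sub hd, binom_natCast, Nat.choose_symm_of_eq_add (show A = x - d + y by omega)]
    · rw [binom_eq_zero (by omega), Nat.choose_eq_zero_of_lt (by omega), Nat.cast_zero]
  have h2 := choose_mul_factorials (x := y) (y := x) (h.trans (add_comm x y))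
  rw [h1, mul_comm (x ! : ℤ)]
  exact_mod_cast h2

section Entries

variable {a b c r r' s s' k : ℕ}

theorem lowPaths_mul_factorials (hr : r + r' = a + 2) (hk : k ≤ c + 2) :
    lowPaths (b + 2) r 1 ((k : ℤ) - 1) * ((k + b)! * (a + c + 2 - k)!) =
      (b + r)! * (r' + c)! * (a + c + 2 - k).choose (r' + c) := by
  have h1 : lowPaths (b + 2) r 1 ((k : ℤ) - 1) = (b + r).choose (k + b) := by
    unfold lowPaths
    rw [if_neg (by push_cast; omega), zero_add, ← binom_natCast]
    congr 1 <;> push_cast <;> ring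
  rw [h1]
  exact_mod_cast choose_mul_factorials (A := b + r) (d := r' + c) (x := k + b)
    (y := a + c + 2 - k) (by omega)

theorem topPaths_mul_factorials (hs : s + s' = b + 2) (hk : k ≤ c + 2) :
    topPaths (a + 2) (b + 2) (c + 2) s 1 ((k : ℤ) - 1) * ((k + b)! * (a + c + 2 - k)!) =
      (a + s')! * (s + c)! * (k + b).choose (s + c) := by
  have h1 : topPaths (a + 2) (b + 2) (c + 2) s 1 ((k : ℤ) - 1) =
      binom (a + s' : ℕ) (((k + b : ℕ) : ℤ) - (s + c : ℕ)) := by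
    unfold topPaths
    rw [if_neg (by push_cast; omega), zero_add]
    congr 1 <;> push_cast <;> omega
  rw [h1]
  exact binom_sub_mul_factorials (by omega)

/-- The purpose of the moved endpoints: the right side is a polynomial in k of degree only e. -/
theorem midPaths_mul_factorials {e : ℕ} (he : e < c) (hk : k ≤ c + 2) :
    midPaths (a + 2) (b + 2) (c + 2) (e + 1) 1 ((k : ℤ) - 1) * ((k + b)! * (a + c + 2 - k)!) =
      (a + b + c + 2 - e)! * e ! * (k + b).choose e := by
  have h1 : midPaths (a + 2) (b + 2) (c + 2) (e + 1) 1 ((k : ℤ) - 1) =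
      binom (a + b + c + 2 - e : ℕ) (((k + b : ℕ) : ℤ) - (e : ℕ)) := by
    unfold midPaths
    congr 1 <;> push_cast <;> omega
  rw [h1]
  exact binom_sub_mul_factorials (by omega)

/-- Absorption leaves a difference of order c + j'. Only the columns j = 0, 1, 2 are needed, whence
j + j' = 2, and r! r'! clears the remaining denominators. -/
theorem low_sum {j j' : ℕ} (hr : r + r' = a + 2) (hj : j + j' = 2) :
    (∑ k ∈ range (c + 3), (-1 : ℚ) ^ k * (c + 2).choose k *
      ((a + c + 2 - k).choose (r' + c) : ℚ) * (k.descFactorial j : ℚ)) * (r ! * r' !) =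
      a ! * ((-1) ^ j * (c + 2).descFactorial j * (r.descFactorial j * r'.descFactorial j')) := by
  have h1 := sum_alternating_choose_mul_descFactorial (c + j') j
    (fun k => ((a + c + 2 - k).choose (r' + c) : ℚ))
  rw [show c + j' + j = c + 2 by omega] at h1
  rw [h1]
  have h2 : ∀ i, a + c + 2 - (i + j) = a + c + j' - i := by intro i; omega
  simp only [h2]
  rw [sum_alternating_choose_mul_choose_sub (by omega), show a + c + j' - (c + j') = a by omega,
    show r' + c - (c + j') = r' - j' by omega]
  have h3 := choose_sub_mul_factorial_mul_factorial (a := a) (j := j) (j' := j')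
    (r := r) (r' := r') (by omega)
  rw [if_congr (show c + j' ≤ r' + c ↔ j' ≤ r' by omega) rfl rfl, mul_assoc, h3]
  ring

theorem top_sum {j j' : ℕ} (hs : s + s' = b + 2) (hj : j + j' = 2) :
    (∑ k ∈ range (c + 3), (-1 : ℚ) ^ k * (c + 2).choose k *
      ((k + b).choose (s + c) : ℚ) * (k.descFactorial j : ℚ)) * (s ! * s' !) =
      (-1) ^ c * ((c + 2).descFactorial j * ((b + j)! * s.descFactorial j')) := by
  have h1 := sum_alternating_choose_mul_descFactorial (c + j') j
    (fun k => ((k + b).choose (s + c) : ℚ))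
  rw [show c + j' + j = c + 2 by omega] at h1
  rw [h1]
  have h2 : ∀ i, i + j + b = b + j + i := by intro i; omega
  simp only [h2]
  rw [sum_alternating_choose_mul_choose_add, show s + c - (c + j') = s - j' by omega]
  have h3 := choose_sub_mul_factorial_mul_factorial (a := b + j) (j := 0) (j' := j')
    (r := s') (r' := s) (by omega)
  rw [Nat.descFactorial_zero, Nat.cast_one, one_mul] at h3
  rw [if_congr (show c + j' ≤ s + c ↔ j' ≤ s by omega) rfl rfl]
  have h4 : (-1 : ℚ) ^ j * (-1) ^ (c + j') = (-1) ^ c := by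
    rw [← pow_add, show j + (c + j') = c + 2 by omega, pow_add]
    norm_num
  linear_combination ((-1 : ℚ) ^ j * (-1) ^ (c + j') * (c + 2).descFactorial j) * h3 +
    ((c + 2).descFactorial j * ((b + j)! * s.descFactorial j') : ℚ) * h4

/-- An n-th difference kills polynomials of degree below n and sees only the leading coefficient in
degree n. -/
theorem mid_sum {n e j : ℕ} (h : e + j ≤ n) :
    ∑ k ∈ range (n + 1), (-1 : ℚ) ^ k * n.choose k * ((k + b).choose e : ℚ) *
      (k.descFactorial j : ℚ) = if e + j = n then (-1) ^ n * (n.descFactorial j : ℚ) else 0 := by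
  obtain ⟨m, rfl⟩ := Nat.exists_eq_add_of_le' (le_of_add_left_le h)
  rw [sum_alternating_choose_mul_descFactorial m j (fun k => ((k + b).choose e : ℚ))]
  have h2 : ∀ i, i + j + b = j + b + i := by intro i; omega
  simp only [h2]
  rw [sum_alternating_choose_mul_choose_add]
  split_ifs with h3 h4 h4
  · obtain rfl : e = m := by omega
    simp only [Nat.sub_self, Nat.choose_zero_right, Nat.cast_one]
    ring
  · omega
  · omega
  · simp

end Entries


/-! ### The bordered matrix and its block triangular product -/

theorem exists_sign_det_submatrix {m n : Type*} [Fintype m] [DecidableEq m] [Fintype n]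
    [DecidableEq n] (e₁ e₂ : m ≃ n) : ∃ ε : ℚ, (ε = 1 ∨ ε = -1) ∧
      ∀ M : Matrix n n ℚ, (M.submatrix e₁ e₂).det = ε * M.det := by
  refine ⟨((Equiv.Perm.sign (e₂.symm.trans e₁) : ℤˣ) : ℤ), ?_, fun M => ?_⟩
  · rcases Int.units_eq_one_or (Equiv.Perm.sign (e₂.symm.trans e₁)) with h | h <;> simp [h]
  · rw [← Matrix.det_permute, ← Matrix.det_submatrix_equiv_self e₂]
    congr 1
    ext i j
    simp

/-- The order of the rows: the middle endpoints, then the auxiliary row and the lowest and highest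
endpoints. -/
noncomputable def rowEquiv (c : ℕ) : Fin c ⊕ Fin 3 ≃ Fin (c + 3) :=
  Equiv.ofBijective (Sum.elim (fun e => ⟨e + 2, by omega⟩) ![0, 1, Fin.last _]) (by
    rw [Fintype.bijective_iff_injective_and_card]
    refine ⟨?_, by simp⟩
    rintro (i | i) (j | j) h
    · simpa [Fin.ext_iff] using h
    · fin_cases j <;> simp [Fin.ext_iff] at h
      all_goals omega
    · fin_cases i <;> simp [Fin.ext_iff] at h
      all_goals omega
    · fin_cases i <;> fin_cases j <;> simp [Fin.ext_iff] at h ⊢)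

/-- The order of the columns: decreasing from the highest degree to degree three, then increasing
from degree zero to degree two. -/
noncomputable def colEquiv (c : ℕ) : Fin c ⊕ Fin 3 ≃ Fin (c + 3) :=
  Equiv.ofBijective (Sum.elim (fun e => ⟨c + 2 - e, by omega⟩) (fun j => ⟨j, by omega⟩)) (by
    rw [Fintype.bijective_iff_injective_and_card]
    refine ⟨?_, by simp⟩
    rintro (i | i) (j | j) h
    · simp [Fin.ext_iff] at h ⊢; omega
    · simp [Fin.ext_iff] at h ⊢; omega
    · simp [Fin.ext_iff] at h ⊢; omega
    · simpa [Fin.ext_iff] using h)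

/-- The matrix of path numbers, bordered by a unit row. -/
def borderedMatrix (a b c r s : ℕ) (k₀ : Fin (c + 3)) : Matrix (Fin (c + 3)) (Fin (c + 3)) ℚ :=
  Matrix.of (Fin.cons (Pi.single k₀ 1) fun (i : Fin (c + 2)) k =>
    (pathCount (a + 2) (b + 2) (c + 2) r s i 1 ((k : ℕ) - 1) : ℚ))

/-- Weighted values of falling factorials. -/
def weightMatrix (a b c : ℕ) : Matrix (Fin (c + 3)) (Fin (c + 3)) ℚ :=
  Matrix.of fun k j => (-1) ^ (k : ℕ) * (c + 2).choose k * ((k + b)! * (a + c + 2 - k)! : ℕ) *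
    (k : ℕ).descFactorial j

/-- Expansion along the unit row deletes column c+2-t, that is, the height c+1-t missed by the paths
after the first step. -/
theorem ncard_tilings_eq_det_borderedMatrix {a b c r s t : ℕ} (hr : r ≤ a + 2) (hs : s ≤ b + 2)
    (ht : t ≤ c + 2) :
    (borderedMatrix a b c r s ⟨c + 2 - t, by omega⟩).det =
      (-1) ^ (c + 2 - t) * (tilings a b c r s t).ncard := by
  set k₀ : Fin (c + 3) := ⟨c + 2 - t, by omega⟩ with hk₀
  have h := (ncard_tilings_eq_det hr hs ht).2
  rw [Matrix.det_succ_row_zero, Finset.sum_eq_single k₀]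
  · have h1 : borderedMatrix a b c r s k₀ 0 k₀ = 1 := by simp [borderedMatrix]
    rw [h1, mul_one]
    congr 1
    have h2 : ((tilings a b c r s t).ncard : ℚ) = (((tilings a b c r s t).ncard : ℤ) : ℚ) := by
      simp
    rw [h2, h, ← Matrix.det_transpose, Int.cast_det]
    congr 1
    ext i j
    simp only [Matrix.transpose_apply, Matrix.submatrix_apply, borderedMatrix, Matrix.of_apply,
      Fin.cons_succ, Matrix.map_apply]
    congr 2
    rw [Fin.succAbove]
    simp only [Fin.lt_def, Fin.val_castSucc, hk₀]
    split_ifs <;> simp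
  · intro k _ hk
    have h1 : borderedMatrix a b c r s k₀ 0 k = 0 := by simp [borderedMatrix, hk]
    rw [h1]
    ring
  · simp

theorem det_weightMatrix (a b c : ℕ) : (weightMatrix a b c).det =
    ∏ k ∈ range (c + 3), (-1) ^ k *
      ((c + 2).choose k * ((k + b)! * (a + c + 2 - k)!) * k ! : ℚ) := by
  rw [weightMatrix, Matrix.det_of_isLowerTriangular]
  · rw [← Fin.prod_univ_eq_prod_range]
    refine Finset.prod_congr rfl fun k _ => ?_
    simp only [Matrix.of_apply, Nat.descFactorial_self]
    push_cast
    ring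
  · intro k j hkj
    have : (k : ℕ) < j := hkj
    simp only [Matrix.of_apply]
    rw [Nat.descFactorial_of_lt this]
    simp

theorem bordered_mul_weight_zero (a b c r s : ℕ) (k₀ j : Fin (c + 3)) :
    (borderedMatrix a b c r s k₀ * weightMatrix a b c) 0 j = weightMatrix a b c k₀ j := by
  rw [Matrix.mul_apply, Finset.sum_eq_single k₀]
  · simp [borderedMatrix]
  · intro k _ hk
    simp [borderedMatrix, hk]
  · simp

theorem bordered_mul_weight_succ {a b c r s : ℕ} {k₀ j : Fin (c + 3)} {i : Fin (c + 2)}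
    {C : ℚ} {h : ℕ → ℚ} (hC : ∀ k : ℕ, k ≤ c + 2 →
      (pathCount (a + 2) (b + 2) (c + 2) r s i 1 ((k : ℤ) - 1) : ℚ) *
        ((k + b)! * (a + c + 2 - k)!) = C * h k) :
    (borderedMatrix a b c r s k₀ * weightMatrix a b c) i.succ j =
      C * ∑ k ∈ range (c + 3), (-1 : ℚ) ^ k * (c + 2).choose k * h k *
        (k.descFactorial j : ℚ) := by
  rw [Matrix.mul_apply, ← Fin.sum_univ_eq_sum_range (fun k => (-1 : ℚ) ^ k * (c + 2).choose k *
    h k * (k.descFactorial j : ℚ)), Finset.mul_sum]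
  refine Finset.sum_congr rfl fun k _ => ?_
  simp only [borderedMatrix, weightMatrix, Matrix.of_apply, Fin.cons_succ]
  push_cast
  linear_combination ((-1 : ℚ) ^ (k : ℕ) * (c + 2).choose k * ((k : ℕ).descFactorial j : ℚ)) *
    hC k (by omega)

theorem bordered_mul_weight_low {a b c r r' s : ℕ} (hr : r + r' = a + 2) {k₀ j : Fin (c + 3)}
    {j' : ℕ} (hj : j + j' = 2) :
    (borderedMatrix a b c r s k₀ * weightMatrix a b c) 1 j * (r ! * r' !) =
      (b + r)! * (r' + c)! * a ! *
        ((-1) ^ (j : ℕ) * (c + 2).descFactorial j * (r.descFactorial j * r'.descFactorial j')) := by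
  have h1 : (1 : Fin (c + 3)) = Fin.succ 0 := rfl
  rw [h1, bordered_mul_weight_succ (C := (b + r)! * (r' + c)!)
    (h := fun k => ((a + c + 2 - k).choose (r' + c) : ℚ)), mul_assoc, low_sum hr hj]
  · ring
  · intro k hk
    simp only [pathCount, Fin.val_zero, if_true]
    exact_mod_cast lowPaths_mul_factorials (b := b) hr hk

theorem bordered_mul_weight_top {a b c r s s' : ℕ} (hs : s + s' = b + 2) {k₀ j : Fin (c + 3)}
    {j' : ℕ} (hj : j + j' = 2) :
    (borderedMatrix a b c r s k₀ * weightMatrix a b c) (Fin.last _) j * (s ! * s' !) =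
      (a + s')! * (s + c)! *
        ((-1) ^ c * ((c + 2).descFactorial j * ((b + j)! * s.descFactorial j'))) := by
  rw [← Fin.succ_last, bordered_mul_weight_succ (C := (a + s')! * (s + c)!)
    (h := fun k => ((k + b).choose (s + c) : ℚ)), mul_assoc, top_sum hs hj]
  intro k hk
  have h1 : ((Fin.last (c + 1) : Fin (c + 2)) : ℕ) = c + 1 := rfl
  simp only [pathCount]
  rw [h1, if_neg (Nat.succ_ne_zero c), if_pos rfl]
  exact_mod_cast topPaths_mul_factorials (a := a) hs hk

theorem bordered_mul_weight_mid {a b c r s e : ℕ} {k₀ j : Fin (c + 3)} (he : e < c)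
    (hj : e + j ≤ c + 2) :
    (borderedMatrix a b c r s k₀ * weightMatrix a b c) ⟨e + 2, by omega⟩ j =
      if e + j = c + 2 then (a + b + c + 2 - e)! * ((-1) ^ c * ((c + 2)! : ℚ)) else 0 := by
  have h1 : (⟨e + 2, by omega⟩ : Fin (c + 3)) = Fin.succ ⟨e + 1, by omega⟩ := rfl
  rw [h1, bordered_mul_weight_succ (C := (a + b + c + 2 - e)! * e !)
    (h := fun k => ((k + b).choose e : ℚ)), mid_sum hj]
  · split_ifs with h2
    · have h3 := Nat.factorial_mul_descFactorial (show (j : ℕ) ≤ c + 2 by omega)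
      rw [show c + 2 - (j : ℕ) = e by omega] at h3
      rw [← h3, pow_add]
      push_cast
      ring
    · ring
  · intro k hk
    simp only [pathCount]
    rw [if_neg (by omega), if_neg (by omega)]
    exact_mod_cast midPaths_mul_factorials he hk

/-- The product over the columns of the sizes of the weights. -/
def weightProduct (a b c : ℕ) : ℚ :=
  ∏ k ∈ range (c + 3), ((c + 2).choose k * ((k + b)! * (a + c + 2 - k)!) * k ! : ℚ)

/-- The last factor of the number of tilings, of degree two in each of `r`, `s`, `t`. -/
def quadraticFactor (a b c r s t : ℚ) : ℚ :=
  (a + 1) * (b + 1) * (c + 1) * (a + 2 - r) * (b + 2 - s) * (c + 2 - t)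
    + (a + 1) * (b + 1) * (c + 1) * r * s * t
    - (a + 2 - r) * (b + 2 - s) * (c + 2 - t) * r * s * t
    + (a + 1) * (c + 1) * (b + 2 - s) * (c + 2 - t) * r * s
    + (b + 1) * (a + 1) * (c + 2 - t) * (a + 2 - r) * s * t
    + (c + 1) * (b + 1) * (a + 2 - r) * (b + 2 - s) * t * r

/-- The rows for the lowest and highest endpoints become polynomial after multiplication by F = r!
r'! and G = s! s'!. Each term of the determinant contains one entry of either row, so F G scales it
correctly. -/
theorem det_three_eq {W X Y F G σ a b c r s t k p₀ p₁ p₂ q₀ q₁ q₂ : ℚ}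
    (hp₀ : p₀ * F = X * ((a + 2 - r) * (a + 1 - r))) (hp₁ : p₁ * F = X * (-(c + 2) * r * (a + 2 - r)))
    (hp₂ : p₂ * F = X * ((c + 2) * (c + 1) * (r * (r - 1))))
    (hq₀ : q₀ * G = Y * σ * (s * (s - 1))) (hq₁ : q₁ * G = Y * σ * ((c + 2) * (b + 1) * s))
    (hq₂ : q₂ * G = Y * σ * ((c + 2) * (c + 1) * ((b + 1) * (b + 2)))) (hk : k = c + 2 - t) :
    (W * 1 * p₁ * q₂ - W * 1 * p₂ * q₁ - W * k * p₀ * q₂ + W * k * p₂ * q₀ +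
      W * (k * (k - 1)) * p₀ * q₁ - W * (k * (k - 1)) * p₁ * q₀) * (F * G) =
      -(W * X * Y * σ * ((c + 2) * quadraticFactor a b c r s t)) := by
  calc _ = W * ((p₁ * F) * (q₂ * G) - (p₂ * F) * (q₁ * G) - k * ((p₀ * F) * (q₂ * G)) +
        k * ((p₂ * F) * (q₀ * G)) + k * (k - 1) * ((p₀ * F) * (q₁ * G)) -
        k * (k - 1) * ((p₁ * F) * (q₀ * G))) := by ring
    _ = _ := by
      rw [hp₀, hp₁, hp₂, hq₀, hq₁, hq₂, hk]
      unfold quadraticFactor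
      ring

theorem exists_sign_ncard_tilings (a b c : ℕ) : ∃ ε : ℚ, (ε = 1 ∨ ε = -1) ∧
    ∀ r r' s s' t t' : ℕ, r + r' = a + 2 → s + s' = b + 2 → t + t' = c + 2 →
      (tilings a b c r s t).ncard * weightProduct a b c * (r ! * r' ! * (s ! * s' !)) =
        ε * ((∏ e ∈ range c, ((a + b + c + 2 - e)! : ℚ)) * (c + 2)! ^ c *
          ((c + 2).choose t' * ((t' + b)! * (a + t)!)) * ((b + r)! * (r' + c)! * a !) *
          ((a + s')! * (s + c)! * b !) * ((c + 2) * quadraticFactor a b c r s t)) := by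
  obtain ⟨ε, hε, hdet⟩ := exists_sign_det_submatrix (rowEquiv c) (colEquiv c)
  have hsign : ∀ m : ℕ, (-1 : ℚ) ^ m = 1 ∨ (-1 : ℚ) ^ m = -1 := fun m => neg_one_pow_eq_or ℚ m
  set δ : ℚ := ∏ k ∈ range (c + 3), (-1 : ℚ) ^ k with hδ
  have hδ' : δ = 1 ∨ δ = -1 := by
    rw [hδ, Finset.prod_pow_eq_pow_sum]
    exact hsign _
  refine ⟨-(ε * δ * ((-1) ^ c) ^ c * (-1) ^ c), ?_, ?_⟩
  · rcases hε with h1 | h1 <;> rcases hδ' with h2 | h2 <;> rcases hsign c with h3 | h3 <;>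
      rcases hsign (c * c) with h4 | h4 <;> rw [← pow_mul, h1, h2, h3, h4] <;> norm_num
  · intro r r' s s' t t' hr hs ht
    have hk₀ : c + 2 - t < c + 3 := by omega
    set k₀ : Fin (c + 3) := ⟨c + 2 - t, hk₀⟩ with hk₀'
    have hk₀t : (k₀ : ℕ) = t' := by simp only [hk₀']; omega
    set M := borderedMatrix a b c r s k₀ * weightMatrix a b c with hM
    have hM1 : M.det = (-1) ^ t' * (tilings a b c r s t).ncard * (δ * weightProduct a b c) := by
      rw [hM, Matrix.det_mul, hk₀', ncard_tilings_eq_det_borderedMatrix (by omega) (by omega)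
        (by omega), det_weightMatrix, Finset.prod_mul_distrib, show c + 2 - t = t' by omega]
      rfl
    -- The zero block consists of middle rows e < c against columns j ≤ 2, where e + j < c+2.
    have hblock : M.submatrix (rowEquiv c) (colEquiv c) =
        Matrix.fromBlocks (M.submatrix (rowEquiv c ∘ Sum.inl) (colEquiv c ∘ Sum.inl)) 0
          (M.submatrix (rowEquiv c ∘ Sum.inr) (colEquiv c ∘ Sum.inl))
          (M.submatrix (rowEquiv c ∘ Sum.inr) (colEquiv c ∘ Sum.inr)) := by
      ext (i | i) (j | j)
      · rfl
      · have hi := i.isLt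
        have hj := j.isLt
        have := bordered_mul_weight_mid (a := a) (b := b) (r := r) (s := s) (k₀ := k₀)
          (j := ⟨j, by omega⟩) hi (by simp only; omega)
        rw [if_neg (by simp only; omega)] at this
        exact this
      · rfl
      · rfl
    -- `colEquiv` lists the columns c+2, c+1, ..., 3, so the first non-zero entry e + j = c+2 of
    -- each middle row falls on the diagonal.
    have hA : (M.submatrix (rowEquiv c ∘ Sum.inl) (colEquiv c ∘ Sum.inl)).det =
        (∏ e ∈ range c, ((a + b + c + 2 - e)! : ℚ)) * (((-1) ^ c) ^ c * (c + 2)! ^ c) := by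
      have hent : ∀ e j : Fin c, e ≤ j →
          M.submatrix (rowEquiv c ∘ Sum.inl) (colEquiv c ∘ Sum.inl) e j =
          if e = j then (a + b + c + 2 - e)! * ((-1) ^ c * ((c + 2)! : ℚ)) else 0 := by
        intro e j hej
        have hej' : (e : ℕ) ≤ j := hej
        have hj := j.isLt
        refine (bordered_mul_weight_mid (a := a) (b := b) (r := r) (s := s) (k₀ := k₀)
          (j := ⟨c + 2 - j, by omega⟩) e.isLt (by simp only; omega)).trans ?_
        refine if_congr ?_ rfl rfl
        simp only [Fin.ext_iff]
        omega
      rw [Matrix.det_of_isLowerTriangular]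
      · rw [Finset.prod_congr rfl (fun e _ => (hent e e le_rfl).trans (if_pos rfl)),
          Finset.prod_mul_distrib, Fin.prod_univ_eq_prod_range (fun e => ((a + b + c + 2 - e)! : ℚ)),
          Finset.prod_const, Finset.card_fin, mul_pow]
      · intro e j hej
        have hej' : e < j := hej
        rw [hent e j hej'.le, if_neg hej'.ne]
    have hD : (M.submatrix (rowEquiv c ∘ Sum.inr) (colEquiv c ∘ Sum.inr)).det *
        (r ! * r' ! * (s ! * s' !)) =
        -((-1) ^ t' * (-1) ^ c * ((c + 2).choose t' * ((t' + b)! * (a + t)!)) *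
          ((b + r)! * (r' + c)! * a !) * ((a + s')! * (s + c)! * b !) *
          ((c + 2) * quadraticFactor a b c r s t)) := by
      have h0 : ∀ j : Fin (c + 3), M 0 j = (-1) ^ t' * ((c + 2).choose t' *
          ((t' + b)! * (a + t)!)) * (t'.descFactorial j : ℚ) := fun j => by
        rw [hM, bordered_mul_weight_zero]
        simp only [weightMatrix, Matrix.of_apply, hk₀t, show a + c + 2 - t' = a + t by omega]
        push_cast
        ring
      have h1 := fun (j : Fin (c + 3)) (j' : ℕ) (hj : j + j' = 2) =>
        bordered_mul_weight_low (b := b) (s := s) (k₀ := k₀) hr hj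
      have h2 := fun (j : Fin (c + 3)) (j' : ℕ) (hj : j + j' = 2) =>
        bordered_mul_weight_top (a := a) (r := r) (k₀ := k₀) hs hj
      simp only [← hM] at h1 h2
      have c0 : colEquiv c (.inr 0) = ⟨0, by omega⟩ := rfl
      have c1 : colEquiv c (.inr 1) = ⟨1, by omega⟩ := rfl
      have c2 : colEquiv c (.inr 2) = ⟨2, by omega⟩ := rfl
      have r0 : rowEquiv c (.inr 0) = 0 := rfl
      have r1 : rowEquiv c (.inr 1) = 1 := rfl
      have r2 : rowEquiv c (.inr 2) = Fin.last _ := rfl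
      rw [Matrix.det_fin_three]
      simp only [Matrix.submatrix_apply, Function.comp_apply, c0, c1, c2, r0, r1, r2, h0]
      have l0 := h1 ⟨0, by omega⟩ 2 rfl
      have l1 := h1 ⟨1, by omega⟩ 1 rfl
      have l2 := h1 ⟨2, by omega⟩ 0 rfl
      have m0 := h2 ⟨0, by omega⟩ 2 rfl
      have m1 := h2 ⟨1, by omega⟩ 1 rfl
      have m2 := h2 ⟨2, by omega⟩ 0 rfl
      have d2 : ∀ m : ℕ, (m.descFactorial 2 : ℚ) = m * (m - 1) := fun m => by
        rw [Nat.descFactorial_succ, Nat.descFactorial_one]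
        obtain rfl | hm := Nat.eq_zero_or_pos m
        · simp
        · push_cast [Nat.cast_sub hm]
          ring
      simp only [d2, Nat.descFactorial_zero, Nat.descFactorial_one, Nat.add_zero,
        Nat.factorial_succ] at l0 l1 l2 m0 m1 m2 ⊢
      push_cast at l0 l1 l2 m0 m1 m2 ⊢
      have hr' : (r' : ℚ) = a + 2 - r := by
        rw [eq_sub_iff_add_eq']; exact_mod_cast hr
      have ht' : (t' : ℚ) = c + 2 - t := by
        rw [eq_sub_iff_add_eq']; exact_mod_cast ht
      refine (det_three_eq (X := (b + r)! * (r' + c)! * a !) (Y := (a + s')! * (s + c)! * b !)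
        (σ := (-1) ^ c) (a := a) (b := b) (c := c) (r := r) (s := s) (t := t)
        ?_ ?_ ?_ ?_ ?_ ?_ ht').trans ?_
      · rw [l0, hr']; ring
      · rw [l1, hr']; ring
      · rw [l2]; ring
      · rw [m0]; ring
      · rw [m1]; ring
      · rw [m2]; ring
      · ring
    have hfin := hdet M
    rw [hblock, Matrix.det_fromBlocks_zero₁₂, hA, hM1] at hfin
    generalize (M.submatrix (rowEquiv c ∘ Sum.inr) (colEquiv c ∘ Sum.inr)).det = D at hfin hD
    have e1 : ε * ε = 1 := by rcases hε with h | h <;> rw [h] <;> norm_num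
    have e2 : δ * δ = 1 := by rcases hδ' with h | h <;> rw [h] <;> norm_num
    have e3 : (-1 : ℚ) ^ t' * (-1) ^ t' = 1 := by rcases hsign t' with h | h <;> rw [h] <;> norm_num
    generalize ((tilings a b c r s t).ncard : ℚ) = N at hfin ⊢
    generalize ((-1 : ℚ) ^ t') = τ at hfin hD e3
    calc N * weightProduct a b c * (r ! * r' ! * (s ! * s' !))
        = (ε * ε) * (δ * δ) * (τ * τ) * (N * weightProduct a b c * (r ! * r' ! * (s ! * s' !))) := by
          rw [e1, e2, e3]; ring
      _ = (ε * δ * τ) * (ε * (τ * N * (δ * weightProduct a b c))) *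
            (r ! * r' ! * (s ! * s' !)) := by ring
      _ = (ε * δ * τ) * ((∏ e ∈ range c, ((a + b + c + 2 - e)! : ℚ)) *
            (((-1) ^ c) ^ c * (c + 2)! ^ c)) * (D * (r ! * r' ! * (s ! * s' !))) := by
          rw [← hfin]; ring
      _ = _ := by
          rw [hD]
          generalize ((-1 : ℚ) ^ c) ^ c = ρ
          generalize (-1 : ℚ) ^ c = σ
          generalize (∏ e ∈ range c, ((a + b + c + 2 - e)! : ℚ)) = U
          generalize ((c + 2)! : ℚ) ^ c = V
          generalize ((c + 2).choose t' * ((t' + b)! * (a + t)!) : ℚ) = W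
          generalize ((b + r)! * (r' + c)! * a ! : ℚ) = X
          generalize ((a + s')! * (s + c)! * b ! : ℚ) = Y
          generalize ((c + 2) * quadraticFactor a b c r s t : ℚ) = Q
          linear_combination (-(ε * δ * U * ρ * V * σ * W * X * Y * Q)) * e3


/-! ### Products of factorials and the final sign -/

theorem rising_natCast_succ_mul_factorial (m n : ℕ) : rising (m + 1) n * m ! = (m + n)! := by
  unfold rising
  induction n with
  | zero => simp
  | succ n ih =>
    rw [prod_range_succ, mul_right_comm, ih, ← Nat.add_assoc, Nat.factorial_succ]
    push_cast
    ring

theorem rising_natCast_succ_pos (m n : ℕ) : 0 < rising (m + 1) n :=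
  prod_pos fun i _ => by positivity

theorem prodFactorial_pos (n : ℕ) : 0 < prodFactorial n :=
  prod_pos fun k _ => by exact_mod_cast Nat.factorial_pos k

theorem prodFactorial_succ (n : ℕ) : prodFactorial (n + 1) = prodFactorial n * (n + 1)! := by
  unfold prodFactorial
  rw [prod_range_succ]

theorem prod_factorial_add_mul_prodFactorial (m n : ℕ) :
    (∏ k ∈ range n, ((k + (m + 1))! : ℚ)) * prodFactorial m = prodFactorial (m + n) := by
  unfold prodFactorial
  rw [show m + n + 1 = m + 1 + n by ring, prod_range_add _ (m + 1), mul_comm]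
  congr 1
  exact prod_congr rfl fun k _ => by rw [Nat.add_comm]

theorem prod_factorial_add_mul_prodFactorial' (m n : ℕ) :
    (∏ k ∈ range (n + 1), ((k + m)! : ℚ)) * prodFactorial m = prodFactorial (m + n) * m ! := by
  rw [prod_range_succ', Nat.zero_add]
  have h : ∀ k, k + 1 + m = k + (m + 1) := fun k => by ring
  simp only [h]
  rw [mul_right_comm, prod_factorial_add_mul_prodFactorial]

theorem prod_factorial_sub (m n : ℕ) :
    ∏ k ∈ range (n + 1), ((m + n - k)! : ℚ) = ∏ k ∈ range (n + 1), ((k + m)! : ℚ) := by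
  rw [← prod_range_reflect (fun k => ((k + m)! : ℚ))]
  refine prod_congr rfl fun k hk => ?_
  rw [mem_range] at hk
  congr 2
  omega

theorem prod_choose_mul_factorial (n : ℕ) :
    (∏ k ∈ range (n + 1), (n.choose k * k ! : ℚ)) * prodFactorial n = (n ! : ℚ) ^ (n + 1) := by
  have h : prodFactorial n = ∏ k ∈ range (n + 1), ((n - k)! : ℚ) := by
    have := prod_factorial_sub 0 n
    simp only [Nat.zero_add, Nat.add_zero] at this
    rw [this, prodFactorial]
  rw [h, ← prod_mul_distrib, prod_congr rfl (g := fun _ => (n ! : ℚ)), prod_const, card_range]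
  intro k hk
  rw [mem_range] at hk
  exact_mod_cast Nat.choose_mul_factorial_mul_factorial (show k ≤ n by omega)

theorem weightProduct_mul (a b c : ℕ) :
    weightProduct a b c * (prodFactorial a * prodFactorial b * prodFactorial (c + 2)) =
      (c + 2)! ^ (c + 3) * (prodFactorial (b + c + 2) * b !) *
        (prodFactorial (a + c + 2) * a !) := by
  have h1 := prod_choose_mul_factorial (c + 2)
  have h2 := prod_factorial_add_mul_prodFactorial' b (c + 2)
  have h3 := prod_factorial_add_mul_prodFactorial' a (c + 2)
  rw [← prod_factorial_sub] at h3
  have h4 : weightProduct a b c = (∏ k ∈ range (c + 2 + 1), ((c + 2).choose k * k ! : ℚ)) *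
      (∏ k ∈ range (c + 2 + 1), ((k + b)! : ℚ)) *
        ∏ k ∈ range (c + 2 + 1), ((a + (c + 2) - k)! : ℚ) := by
    rw [weightProduct, ← prod_mul_distrib, ← prod_mul_distrib]
    refine prod_congr rfl fun k _ => ?_
    rw [show a + (c + 2) - k = a + c + 2 - k by omega]
    ring
  rw [h4, show b + c + 2 = b + (c + 2) by ring, show a + c + 2 = a + (c + 2) by ring, ← h1, ← h2,
    ← h3]
  ring

/-- The claimed number of tilings, in terms of the distances to both ends of the sides. -/
def tilingFormula (a b c r r' s s' t t' : ℕ) : ℚ :=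
  rising (r + 1) b * rising (s + 1) c * rising (t + 1) a * rising (t' + 1) b *
    rising (r' + 1) c * rising (s' + 1) a *
    ((prodFactorial a * prodFactorial b * prodFactorial c * prodFactorial (a + b + c + 2)) /
      (prodFactorial (b + c + 2) * prodFactorial (a + c + 2) * prodFactorial (a + b + 2))) *
    quadraticFactor a b c r s t

/-- The cancellation in abstract form: the x are the products of factorials, the R the rising
factorials, the u the factorials of r, r', s, s', t, t'. Further, v = b!, w = a!, g = (c+1)!, h =
(c+2)!, z = h^c and n = c+2. -/
theorem formula_mul_eq {x₀ x₁ x₂ x₃ x₄ x₅ x₆ R₁ R₂ R₃ R₄ R₅ R₆ u₁ u₂ u₃ u₄ u₅ u₆ v w g h z n Q : ℚ}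
    (h₁ : x₁ ≠ 0) (h₂ : x₂ ≠ 0) (h₃ : x₃ ≠ 0) (h₄ : x₄ ≠ 0) (h₅ : x₅ ≠ 0) (h₇ : u₅ ≠ 0)
    (h₈ : u₆ ≠ 0) (hg : g ≠ 0) (hh : h ≠ 0) :
    R₁ * R₂ * R₃ * R₄ * R₅ * R₆ * (x₁ * x₂ * x₃ * x₀ / (x₄ * x₅ * x₆)) * Q *
      (z * h * h * (n * g) * (x₄ * v) * (x₅ * w) / (x₁ * x₂ * (x₃ * g * h))) *
      (u₁ * u₂ * (u₃ * u₄)) =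
    x₀ / x₆ * z * (h / (u₅ * u₆) * (R₄ * u₆ * (R₃ * u₅))) * (R₁ * u₁ * (R₅ * u₂) * w) *
      (R₆ * u₄ * (R₂ * u₃) * v) * (n * Q) := by
  have e₁ : x₁ * x₂ * x₃ * x₀ / (x₄ * x₅ * x₆) *
      (z * h * h * (n * g) * (x₄ * v) * (x₅ * w) / (x₁ * x₂ * (x₃ * g * h))) =
      x₀ / x₆ * (z * h * n * v * w) := by field_simp
  have e₂ : h / (u₅ * u₆) * (R₄ * u₆ * (R₃ * u₅)) = h * R₄ * R₃ := by field_simp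
  rw [e₂]
  linear_combination (R₁ * R₂ * R₃ * R₄ * R₅ * R₆ * Q * (u₁ * u₂ * (u₃ * u₄))) * e₁

theorem tilingFormula_mul {a b c r r' s s' t t' : ℕ} (ht : t + t' = c + 2) :
    tilingFormula a b c r r' s s' t t' * weightProduct a b c * (r ! * r' ! * (s ! * s' !)) =
      (∏ e ∈ range c, ((a + b + c + 2 - e)! : ℚ)) * (c + 2)! ^ c *
        ((c + 2).choose t' * ((t' + b)! * (a + t)!)) * ((b + r)! * (r' + c)! * a !) *
        ((a + s')! * (s + c)! * b !) * ((c + 2) * quadraticFactor a b c r s t) := by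
  have hw := weightProduct_mul a b c
  have hU : (∏ e ∈ range c, ((a + b + c + 2 - e)! : ℚ)) * prodFactorial (a + b + 2) =
      prodFactorial (a + b + c + 2) := by
    have h1 := prod_factorial_add_mul_prodFactorial (a + b + 2) c
    rw [show a + b + c + 2 = a + b + 2 + c by ring, ← h1, ← prod_range_reflect]
    congr 1
    refine prod_congr rfl fun k hk => ?_
    rw [mem_range] at hk
    congr 2
    omega
  have hc : prodFactorial (c + 2) = prodFactorial c * (c + 1)! * (c + 2)! := by
    rw [prodFactorial_succ, prodFactorial_succ]
  have hn : ((c + 2)! : ℚ) = (c + 2) * (c + 1)! := by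
    rw [Nat.factorial_succ]; push_cast; ring
  have hch : ((c + 2).choose t' : ℚ) * (t ! * t' !) = (c + 2)! := by
    have := Nat.add_choose_mul_factorial_mul_factorial t t'
    rw [ht] at this
    rw [← mul_assoc]
    exact_mod_cast this
  have f : ∀ m : ℕ, (m ! : ℚ) ≠ 0 := fun m => by exact_mod_cast Nat.factorial_ne_zero m
  have pf : ∀ m, prodFactorial m ≠ 0 := fun m => (prodFactorial_pos m).ne'
  rw [hc] at hw
  rw [Nat.add_comm a t, Nat.add_comm b r, Nat.add_comm a s',
    ← rising_natCast_succ_mul_factorial r b, ← rising_natCast_succ_mul_factorial s c,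
    ← rising_natCast_succ_mul_factorial t a, ← rising_natCast_succ_mul_factorial t' b,
    ← rising_natCast_succ_mul_factorial r' c, ← rising_natCast_succ_mul_factorial s' a]
  have hW : weightProduct a b c = (c + 2)! ^ (c + 3) * (prodFactorial (b + c + 2) * b !) *
        (prodFactorial (a + c + 2) * a !) / (prodFactorial a * prodFactorial b *
          (prodFactorial c * (c + 1)! * (c + 2)!)) := by
    rw [eq_div_iff, hw]
    simp [pf, f]
  have hC : ((c + 2).choose t' : ℚ) = (c + 2)! / (t ! * t' !) := by
    rw [eq_div_iff (mul_ne_zero (f _) (f _)), hch]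
  have hU' : (∏ e ∈ range c, ((a + b + c + 2 - e)! : ℚ)) =
      prodFactorial (a + b + c + 2) / prodFactorial (a + b + 2) := by
    rw [eq_div_iff (pf _), hU]
  rw [tilingFormula, hW, hC, hU']
  have hp : ((c + 2)! : ℚ) ^ (c + 3) = (c + 2)! ^ c * (c + 2)! * (c + 2)! * ((c + 2) * (c + 1)!) := by
    rw [← hn]; ring
  rw [hp]
  exact formula_mul_eq (pf _) (pf _) (pf _) (pf _) (pf _) (f _) (f _) (f _) (f _)

theorem ncard_tilings_eq_tilingFormula {a b c r r' s s' t t' : ℕ} (hr : r + r' = a + 2)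
    (hs : s + s' = b + 2) (ht : t + t' = c + 2) :
    ((tilings a b c r s t).ncard : ℚ) = tilingFormula a b c r r' s s' t t' := by
  obtain ⟨ε, hε, h⟩ := exists_sign_ncard_tilings a b c
  have hw : weightProduct a b c ≠ 0 := by
    refine prod_ne_zero_iff.2 fun k hk => ?_
    rw [mem_range] at hk
    have := (Nat.choose_pos (show k ≤ c + 2 by omega)).ne'
    have := fun m => Nat.factorial_ne_zero m
    simp_all
  have key : ∀ r r' s s' t t' : ℕ, r + r' = a + 2 → s + s' = b + 2 → t + t' = c + 2 →
      ((tilings a b c r s t).ncard : ℚ) = ε * tilingFormula a b c r r' s s' t t' := by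
    intro r r' s s' t t' hr hs ht
    have h1 := h r r' s s' t t' hr hs ht
    rw [← tilingFormula_mul ht] at h1
    have hf : (r ! * r' ! * (s ! * s' !) : ℚ) ≠ 0 := by positivity
    have h2 : (weightProduct a b c) * (r ! * r' ! * (s ! * s' !) : ℚ) ≠ 0 := mul_ne_zero hw hf
    refine mul_right_cancel₀ h2 ?_
    linear_combination h1
  rcases hε with rfl | rfl
  · rw [key r r' s s' t t' hr hs ht, one_mul]
  · exfalso
    -- At r = s = t = 0 only the first summand of the quadratic factor survives and the formula is
    -- positive, so the sign -1 would make a cardinality negative.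
    have h0 := key 0 (a + 2) 0 (b + 2) 0 (c + 2) (by ring) (by ring) (by ring)
    have hpos : 0 < tilingFormula a b c 0 (a + 2) 0 (b + 2) 0 (c + 2) := by
      unfold tilingFormula
      have hQ : 0 < quadraticFactor a b c (0 : ℕ) (0 : ℕ) (0 : ℕ) := by
        have : quadraticFactor a b c (0 : ℕ) (0 : ℕ) (0 : ℕ) =
            (a + 1) * (b + 1) * (c + 1) * (a + 2) * (b + 2) * (c + 2) := by
          unfold quadraticFactor; push_cast; ring
        rw [this]
        positivity
      have p := prodFactorial_pos
      have q := rising_natCast_succ_pos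
      have := p a
      have := p b
      have := p c
      have := p (a + b + c + 2)
      have := p (b + c + 2)
      have := p (a + c + 2)
      have := p (a + b + 2)
      have := q 0 a
      have := q 0 b
      have := q 0 c
      have := q (c + 2) b
      have := q (a + 2) c
      have := q (b + 2) a
      positivity
    have hN : (0 : ℚ) ≤ (tilings a b c 0 0 0).ncard := Nat.cast_nonneg _
    linarith

end RhombusTiling

theorem theorem1 (a b c r s t : ℕ) (hr : r ≤ a + 2) (hs : s ≤ b + 2) (ht : t ≤ c + 2) :
    (RhombusTiling.tilings a b c r s t).Finite ∧
    ((RhombusTiling.tilings a b c r s t).ncard : ℚ) =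
      RhombusTiling.rising (r + 1) b * RhombusTiling.rising (s + 1) c *
      RhombusTiling.rising (t + 1) a * RhombusTiling.rising (c + 3 - t) b *
      RhombusTiling.rising (a + 3 - r) c * RhombusTiling.rising (b + 3 - s) a *
      ((RhombusTiling.prodFactorial a * RhombusTiling.prodFactorial b *
          RhombusTiling.prodFactorial c * RhombusTiling.prodFactorial (a + b + c + 2)) /
        (RhombusTiling.prodFactorial (b + c + 2) * RhombusTiling.prodFactorial (a + c + 2) *
          RhombusTiling.prodFactorial (a + b + 2))) *
      ((a + 1) * (b + 1) * (c + 1) * (a + 2 - r) * (b + 2 - s) * (c + 2 - t)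
        + (a + 1) * (b + 1) * (c + 1) * r * s * t
        - (a + 2 - r) * (b + 2 - s) * (c + 2 - t) * r * s * t
        + (a + 1) * (c + 1) * (b + 2 - s) * (c + 2 - t) * r * s
        + (b + 1) * (a + 1) * (c + 2 - t) * (a + 2 - r) * s * t
        + (c + 1) * (b + 1) * (a + 2 - r) * (b + 2 - s) * t * r) := by
  refine ⟨(RhombusTiling.ncard_tilings_eq_det hr hs ht).1, ?_⟩
  obtain ⟨r', hr'⟩ := Nat.exists_eq_add_of_le hr
  obtain ⟨s', hs'⟩ := Nat.exists_eq_add_of_le hs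
  obtain ⟨t', ht'⟩ := Nat.exists_eq_add_of_le ht
  have e1 : (a : ℚ) + 3 - r = r' + 1 := by
    have : (a : ℚ) + 2 = r + r' := by exact_mod_cast hr'
    linear_combination this
  have e2 : (b : ℚ) + 3 - s = s' + 1 := by
    have : (b : ℚ) + 2 = s + s' := by exact_mod_cast hs'
    linear_combination this
  have e3 : (c : ℚ) + 3 - t = t' + 1 := by
    have : (c : ℚ) + 2 = t + t' := by exact_mod_cast ht'
    linear_combination this
  rw [RhombusTiling.ncard_tilings_eq_tilingFormula hr'.symm hs'.symm ht'.symm, e1, e2, e3]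
  rfl
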